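/- **Notation.** All random elements live on one probability space $(\Omega,\mathcal F,P)$, and $\mathbb R_+^d=[0,\infty)^d$ carries the sup-norm metric. For $v\in\mathbb R_+^d$ let $v^{(1)}\ge\dots\ge v^{(d)}$ be its ordered components. Put $\mathbb{CA}_d^{(i)}=\{v\in\mathbb R_+^d: v^{(i+1)}=0\}$ for $0\le i<d$ (so $\mathbb{CA}_d^{(0)}=\{0\}$) and $\mathbb E_d^{(i)}=\mathbb R_+^d\setminus\mathbb{CA}_d^{(i-1)}=\{v\in\mathbb R_+^d:v^{(i)}>0\}$ for $1\le i\le d$. For $J\subseteq\{1,\dots,d\}$ let $F_J=\{v\in\mathbb R_+^d: v_j>0\iff j\in J\}$. For closed cones $0\in C_0\subset C$, let $\mathbb M(C\setminus C_0)$ be the set of Borel measures on $C\setminus C_0$ that are finite on Borel sets at positive distance from $C_0$. We say $\mu_t\to\mu$ in $\mathbb M(C\setminus C_0)$ if these measures are in $\mathbb M(C\setminus C_0)$ (the $\mu_t$ for all large $t$) and $\int f\,d\mu_t\to\int f\,d\mu$ for every bounded continuous $f:C\setminus C_0\to\mathbb R$ whose support has positive distance from $C_0$. A random vector $V$ with values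 in $C$ is in $\mathcal{MRV}(\alpha,b,\mu,C\setminus C_0)$, with $\alpha\ge0$, if $b$ is regularly varying at infinity with index $1/\alpha$ (rapidly varying if $\alpha=0$), $\mu\in\mathbb M(C\setminus C_0)$ is not the zero measure, and $t\,P(V/b(t)\in\cdot\,)\to\mu$ in $\mathbb M(C\setminus C_0)$ as $t\to\infty$. For $C\setminus C_0=\mathbb E_d^{(i)}$, the canonical scaling is $b(t)=\inf\{x:P(V^{(i)}\le x)\ge 1-1/t\}$. For a matrix $A\in\mathbb R_+^{q\times d}$, $1\le k\le q$ and $1\le j\le d$, put $$\tau^{(k,j)}(A)=\sup_{z\in\mathbb E_d^{(j)}}\frac{(Az)^{(k)}}{z^{(j)}}\in[0,\infty],\qquad i_k(A)=\max\{j\in\{1,\dots,d\}:\tau^{(k,j)}(A)<\infty\}.$$ For a random matrix $A$, put $\Omega_i^{(k)}=\{\omega: i_k(A(\omega))=i\}$ for $1\le i\le d$; these sets form a partition of $\Omega$. **Theorem.** Let $1\le i\le d$ and $1\le k\le q$. Let $Z\in\mathbb R_+^d$ be a random vector with $Z\in\mathcal{MRV}(\alpha_i,b_i,\mu_i,\mathbb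 E_d^{(i)})$, where $b_i$ is the canonical scaling. Let $A$ be a random matrix with values in $\mathbb R_+^{q\times d}$ that is independent of $Z$ and almost surely has no zero row. Assume that 1. for some $\delta>0$, $\displaystyle\int_{\Omega_i^{(k)}}\tau^{(k,i)}(A)^{\alpha_i+\delta}\,dP<\infty$; 2. $\mu_i(F_J)>0$ for every $J\subseteq\{1,\dots,d\}$ with $|J|=i$. Then $$\overline\mu_{i,k}(B)=\int_{\Omega_i^{(k)}}\mu_i\bigl(\{z\in\mathbb E_d^{(i)}:A(\omega)z\in B\}\bigr)\,dP(\omega),\qquad B\subseteq\mathbb E_q^{(k)}\text{ Borel},$$ defines a measure in $\mathbb M(\mathbb E_q^{(k)})$, and, as $t\to\infty$, $$\frac{P\bigl(\{AZ\in t\,\cdot\,\}\cap\Omega_i^{(k)}\bigr)}{P(Z^{(i)}>t)}\longrightarrow\overline\mu_{i,k}(\cdot)\qquad\text{in }\mathbb M(\mathbb E_q^{(k)}).$$ Moreover, $\overline\mu_{i,k}$ is not the zero measure whenever $P(\Omega_i^{(k)})>0$. -/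

import Mathlib

open MeasureTheory ProbabilityTheory Filter Topology Set
open scoped ENNReal Matrix

namespace HiddenRV

noncomputable section

/-! ### Order statistics and subcones of the orthant

The space `Fin d → ℝ` carries the sup-norm metric. -/

/-- The `k`-th largest component `v^{(k)}` of `v` (for `1 ≤ k ≤ d`): the largest `x` such that
at least `k` components of `v` are `≥ x`. -/
def ordStat {d : ℕ} (v : Fin d → ℝ) (k : ℕ) : ℝ :=
  sSup {x : ℝ | k ≤ (Finset.univ.filter fun j => x ≤ v j).card}

/-- `ℝ₊^d = [0, ∞)^d`. -/
def orthant (d : ℕ) : Set (Fin d → ℝ) := {v | ∀ j, 0 ≤ v j}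

/-- `CA_d^{(i)} = {v ∈ ℝ₊^d : v^{(i+1)} = 0}` for `0 ≤ i < d`, the union of all `i`-dimensional
coordinate hyperplanes; it is `{0}` for `i = 0`. -/
def axesUnion (d i : ℕ) : Set (Fin d → ℝ) := {v ∈ orthant d | ordStat v (i + 1) = 0}

/-- `E_d^{(i)} = ℝ₊^d \ CA_d^{(i-1)}` for `1 ≤ i ≤ d`. -/
def subcone (d i : ℕ) : Set (Fin d → ℝ) := orthant d \ axesUnion d (i - 1)

/-- The coordinate face of `ℝ₊^d` on which exactly the coordinates in `J` are positive. -/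
def openFace {d : ℕ} (J : Finset (Fin d)) : Set (Fin d → ℝ) :=
  {v | (∀ j ∈ J, 0 < v j) ∧ ∀ j ∉ J, v j = 0}

/-! ### `M`-convergence -/

/-- `L` is bounded away from `C₀`: `inf {d(x, y) : x ∈ L, y ∈ C₀} > 0`. -/
def BoundedAway {X : Type*} [PseudoMetricSpace X] (L C₀ : Set X) : Prop :=
  ∃ ε : ℝ, 0 < ε ∧ ∀ x ∈ L, ∀ y ∈ C₀, ε ≤ dist x y

/-- `μ ∈ M(C \ C₀)`. A Borel measure on `C \ C₀` is regarded as a Borel measure on the ambient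
space which is carried by `C \ C₀`. -/
structure IsMMeasure {X : Type*} [PseudoMetricSpace X] [MeasurableSpace X]
    (C C₀ : Set X) (μ : Measure X) : Prop where
  carried : μ (C \ C₀)ᶜ = 0
  finite : ∀ B, MeasurableSet B → B ⊆ C \ C₀ → BoundedAway B C₀ → μ B < ∞

/-- `ν t → μ` in `M(C \ C₀)` along the filter `l`: the integrals of all bounded continuous
functions on `C \ C₀` whose support is bounded away from `C₀` converge. -/
structure MTendsto {X ι : Type*} [PseudoMetricSpace X] [MeasurableSpace X]
    (C C₀ : Set X) (ν : ι → Measure X) (l : Filter ι) (μ : Measure X) : Prop where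
  eventually_mem : ∀ᶠ t in l, IsMMeasure C C₀ (ν t)
  limit_mem : IsMMeasure C C₀ μ
  tendsto_integral : ∀ f : X → ℝ, ContinuousOn f (C \ C₀) →
    (∃ M : ℝ, ∀ x ∈ C \ C₀, |f x| ≤ M) → BoundedAway {x ∈ C \ C₀ | f x ≠ 0} C₀ →
    Tendsto (fun t => ∫ x in C \ C₀, f x ∂(ν t)) l (𝓝 (∫ x in C \ C₀, f x ∂μ))

/-! ### Regular variation -/

/-- `f ∈ RV_β`. -/
def IsRegVar (f : ℝ → ℝ) (β : ℝ) : Prop :=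
  (∀ᶠ t in atTop, 0 < f t) ∧
    ∀ x : ℝ, 0 < x → Tendsto (fun t => f (t * x) / f t) atTop (𝓝 (x ^ β))

/-- `f ∈ RV_∞` (rapid variation). -/
def IsRapidVar (f : ℝ → ℝ) : Prop :=
  (∀ᶠ t in atTop, 0 < f t) ∧
    ∀ x : ℝ, 1 < x → Tendsto (fun t => f (t * x) / f t) atTop atTop

/-- `f ∈ RV_{1/α}` for `α ≥ 0`, where `1/0 = ∞`. -/
def IsRegVarInv (f : ℝ → ℝ) (α : ℝ) : Prop :=
  (0 < α ∧ IsRegVar f (1 / α)) ∨ (α = 0 ∧ IsRapidVar f)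

/-- `V ∈ MRV(α, b, μ, C \ C₀)`: `V` is a random vector with values in `C`, `b ∈ RV_{1/α}`,
`μ` is non-null and `t P(V / b(t) ∈ ·) → μ` in `M(C \ C₀)` as `t → ∞`. -/
structure IsMRV {Ω : Type*} [MeasurableSpace Ω] (P : Measure Ω) {d : ℕ} (V : Ω → Fin d → ℝ)
    (α : ℝ) (b : ℝ → ℝ) (μ : Measure (Fin d → ℝ)) (C C₀ : Set (Fin d → ℝ)) : Prop where
  measurable : Measurable V
  mem_cone : ∀ ω, V ω ∈ C
  scaling : IsRegVarInv b α
  nonnull : μ ≠ 0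
  tendsto : MTendsto C C₀
    (fun t : ℝ => ENNReal.ofReal t • (P.map fun ω => (b t)⁻¹ • V ω).restrict (C \ C₀)) atTop μ

/-- The canonical scaling function `b_i(t) = F^←(1 - 1/t)`, where `F` is the distribution
function of `V^{(i)}` and `F^←(s) = inf {x : F(x) ≥ s}`. -/
def canonicalScaling {Ω : Type*} [MeasurableSpace Ω] (P : Measure Ω) {d : ℕ}
    (V : Ω → Fin d → ℝ) (i : ℕ) (t : ℝ) : ℝ :=
  sInf {x : ℝ | P.real {ω | ordStat (V ω) i ≤ x} ≥ 1 - 1 / t}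

/-! ### Matrices -/

/-- The entrywise (product) sigma-algebra on matrices. -/
instance matrixMeasurableSpace {m n R : Type*} [MeasurableSpace R] :
    MeasurableSpace (Matrix m n R) :=
  inferInstanceAs (MeasurableSpace (m → n → R))

/-- `τ_{q,d}^{(k,i)}(A) = sup_{z ∈ E_d^{(i)}} (A z)^{(k)} / z^{(i)} ∈ [0, ∞]`. -/
def matTau {q d : ℕ} (A : Matrix (Fin q) (Fin d) ℝ) (k i : ℕ) : ℝ≥0∞ :=
  ⨆ z ∈ subcone d i, ENNReal.ofReal (ordStat (A *ᵥ z) k / ordStat z i)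

/-- `i_k(A)`, the largest `j ∈ {1, …, d}` with `τ_{q,d}^{(k,j)}(A) < ∞`. -/
def critIndex {q d : ℕ} (A : Matrix (Fin q) (Fin d) ℝ) (k : ℕ) : ℕ :=
  sSup {j : ℕ | 1 ≤ j ∧ j ≤ d ∧ matTau A k j < ∞}

/-- `Ω_i^{(k)} = {ω : i_k(A_ω) = i}`. -/
def critEvent {Ω : Type*} {q d : ℕ} (A : Ω → Matrix (Fin q) (Fin d) ℝ) (k i : ℕ) : Set Ω :=
  {ω | critIndex (A ω) k = i}

end

end HiddenRV

open HiddenRV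

/-!
Condition on the matrix: by independence, for a bounded continuous `F` supported away from the
removed set, the normalised expectation is the average over `ω ∈ Ω_i^{(k)}` of
`E F (A(ω) Z / t) / P (Z^{(i)} > t)`, and the limit is taken under the integral sign.

*Fixed matrix.* If `τ = τ^{(k,i)}(a)` is finite, then `(a z)^{(k)} ≤ τ z^{(i)}` on the orthant
(`ordStat_mulVec_le`), so `z ↦ F (a z)` is again a test function (`IsTest.comp_mulVec`), now for
`E_d^{(i)}`. It remains to pass from convergence along `b(t)` to convergence with normalisation
`P (Z^{(i)} > s)` (`IsMRV.tendsto_integral_div_tail`). Take `t = 1 / P (Z^{(i)} > s)`. Regular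
variation of the generalised inverse `b` gives `b(t) / s → 1`, and the error made by replacing `s`
with `b(t)` is controlled by the oscillation of the test function along rays, which is itself a test
function with small `μ`-integral. The index `α = 0` cannot occur: the mass would escape to
infinity (`IsMRV.index_pos`).

*Domination.* As `F (a Z / t) ≠ 0` forces `Z^{(i)} > t / u` with `u` a multiple of `τ + 1`, the
integrand is at most a multiple of `P (Z^{(i)} > t / u) / P (Z^{(i)} > t)`, hence of
`(τ + 1)^{α + δ}` by a Potter bound (`exists_tail_div_le`); the moment condition makes this
integrable. The same bound shows that the limit measure is finite away from the removed set.

*Non-triviality.* If `i_k(a) = i`, some `i` columns of `a` together have positive entries in at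
least `k` rows: for `i = d` because no row is zero, and for `i < d` because otherwise
`τ^{(k,i+1)}(a)` would be finite (`matTau_succ_lt_top`). So `a` maps an open face of dimension `i`
into `E_q^{(k)}`, and such faces have positive `μ`-measure.
-/

namespace HiddenRV

/-! ### Order statistics -/

section OrdStat

variable {d k : ℕ}

/-- The supremum defining `ordStat` is attained; every property of order statistics below comes
from this Galois-type characterisation. -/
theorem le_ordStat_iff (hk : 1 ≤ k) (hkd : k ≤ d) (v : Fin d → ℝ) (x : ℝ) :
    x ≤ ordStat v k ↔ k ≤ (Finset.univ.filter fun j => x ≤ v j).card := by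
  set S : Set ℝ := {x : ℝ | k ≤ (Finset.univ.filter fun j => x ≤ v j).card} with hS
  have hdown : ∀ {x y}, x ≤ y → y ∈ S → x ∈ S := by
    intro x y hxy hy
    refine le_trans (show k ≤ _ from hy) (Finset.card_le_card ?_)
    intro j
    simp only [Finset.mem_filter, Finset.mem_univ, true_and]
    exact hxy.trans
  have hne : S.Nonempty := by
    obtain ⟨m, hm⟩ := (Set.finite_range v).bddBelow
    refine ⟨m, ?_⟩
    have : (Finset.univ.filter fun j => m ≤ v j) = Finset.univ :=
      Finset.filter_true_of_mem fun j _ => hm ⟨j, rfl⟩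
    simp [hS, this, hkd]
  have hbdd : BddAbove S := by
    obtain ⟨m, hm⟩ := (Set.finite_range v).bddAbove
    refine ⟨m, fun x hx => ?_⟩
    obtain ⟨j, hj⟩ := Finset.card_pos.1 (lt_of_lt_of_le (by omega) (show k ≤ _ from hx))
    exact (Finset.mem_filter.1 hj).2.trans (hm ⟨j, rfl⟩)
  have hclosed : IsClosed S := by
    have : S = ⋃ J ∈ (Finset.univ.filter fun J : Finset (Fin d) => J.card = k),
        ⋂ j ∈ J, Set.Iic (v j) := by
      ext x
      simp only [hS, mem_ofPred_eq, Finset.mem_filter, Finset.mem_univ, true_and, mem_iUnion,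
        mem_iInter, mem_Iic, exists_prop]
      constructor
      · intro h
        obtain ⟨J, hJ, hc⟩ := Finset.exists_subset_card_eq h
        exact ⟨J, hc, fun j hj => (Finset.mem_filter.1 (hJ hj)).2⟩
      · rintro ⟨J, hc, hJ⟩
        rw [← hc]
        exact Finset.card_le_card fun j hj => by simpa using hJ j hj
    rw [this]
    exact isClosed_biUnion_finset fun J _ => isClosed_biInter fun j _ => isClosed_Iic
  exact ⟨fun h => hdown h (hclosed.csSup_mem hne hbdd), fun h => le_csSup hbdd h⟩

theorem ordStat_le_add (hk : 1 ≤ k) (hkd : k ≤ d) {v w : Fin d → ℝ} {c : ℝ}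
    (h : ∀ j, v j ≤ w j + c) : ordStat v k ≤ ordStat w k + c := by
  rw [← sub_le_iff_le_add, le_ordStat_iff hk hkd]
  refine ((le_ordStat_iff hk hkd v _).1 le_rfl).trans (Finset.card_le_card fun j => ?_)
  simp only [Finset.mem_filter, Finset.mem_univ, true_and]
  intro hj
  linarith [h j]

theorem abs_ordStat_sub_le (hk : 1 ≤ k) (hkd : k ≤ d) (v w : Fin d → ℝ) :
    |ordStat v k - ordStat w k| ≤ dist v w := by
  have h : ∀ j, |v j - w j| ≤ dist v w := fun j => by
    rw [← Real.dist_eq]; exact dist_le_pi_dist v w j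
  rw [abs_le]
  constructor
  · have := ordStat_le_add hk hkd (v := w) (w := v) (c := dist v w)
      fun j => by linarith [(abs_le.1 (h j)).1]
    linarith
  · have := ordStat_le_add hk hkd (v := v) (w := w) (c := dist v w)
      fun j => by linarith [(abs_le.1 (h j)).2]
    linarith

theorem continuous_ordStat (hk : 1 ≤ k) (hkd : k ≤ d) :
    Continuous fun v : Fin d → ℝ => ordStat v k :=
  (LipschitzWith.of_dist_le_mul (K := 1) fun v w => by
    simpa [Real.dist_eq] using abs_ordStat_sub_le hk hkd v w).continuous

theorem ordStat_smul (hk : 1 ≤ k) (hkd : k ≤ d) {c : ℝ} (hc : 0 < c) (v : Fin d → ℝ) :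
    ordStat (c • v) k = c * ordStat v k := by
  refine eq_of_forall_le_iff fun x => ?_
  rw [le_ordStat_iff hk hkd, ← div_le_iff₀' hc, le_ordStat_iff hk hkd]
  simp only [Pi.smul_apply, smul_eq_mul, div_le_iff₀' hc]

theorem ordStat_nonneg (hk : 1 ≤ k) (hkd : k ≤ d) {v : Fin d → ℝ} (hv : v ∈ orthant d) :
    0 ≤ ordStat v k := by
  rw [le_ordStat_iff hk hkd, Finset.filter_true_of_mem fun j _ => hv j]
  simpa using hkd

theorem lt_ordStat_iff (hk : 1 ≤ k) (hkd : k ≤ d) (v : Fin d → ℝ) (x : ℝ) :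
    x < ordStat v k ↔ k ≤ (Finset.univ.filter fun j => x < v j).card := by
  constructor
  · intro h
    refine ((le_ordStat_iff hk hkd v _).1 le_rfl).trans (Finset.card_le_card fun j => ?_)
    simp only [Finset.mem_filter, Finset.mem_univ, true_and]
    exact h.trans_le
  · intro h
    obtain ⟨J, hJ, hc⟩ := Finset.exists_subset_card_eq h
    have hne : J.Nonempty := Finset.card_pos.1 (by omega)
    obtain ⟨j₀, hj₀, hmin⟩ := J.exists_min_image v hne
    refine lt_of_lt_of_le (Finset.mem_filter.1 (hJ hj₀)).2 ((le_ordStat_iff hk hkd v _).2 ?_)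
    rw [← hc]
    exact Finset.card_le_card fun j hj => by simpa using hmin j hj

theorem mem_subcone_iff (hk : 1 ≤ k) (hkd : k ≤ d) {v : Fin d → ℝ} :
    v ∈ subcone d k ↔ v ∈ orthant d ∧ 0 < ordStat v k := by
  simp only [subcone, axesUnion, Nat.sub_add_cancel hk, Set.mem_sdiff, mem_ofPred_eq, not_and]
  exact ⟨fun h => ⟨h.1, lt_of_le_of_ne (ordStat_nonneg hk hkd h.1) (Ne.symm (h.2 h.1))⟩,
    fun h => ⟨h.1, fun _ => h.2.ne'⟩⟩

theorem measurableSet_orthant : MeasurableSet (orthant d) := by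
  have : orthant d = ⋂ j, {v | 0 ≤ v j} := by ext; simp [orthant]
  rw [this]
  exact MeasurableSet.iInter fun j => measurableSet_le measurable_const (measurable_pi_apply j)

theorem measurable_ordStat (hk : 1 ≤ k) (hkd : k ≤ d) :
    Measurable fun v : Fin d → ℝ => ordStat v k :=
  (continuous_ordStat hk hkd).measurable

theorem measurableSet_subcone (hk : 1 ≤ k) (hkd : k ≤ d) : MeasurableSet (subcone d k) := by
  have : subcone d k = orthant d ∩ {v | 0 < ordStat v k} := by
    ext v; simp [mem_subcone_iff hk hkd]
  rw [this]
  exact measurableSet_orthant.inter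
    (measurableSet_lt measurable_const (measurable_ordStat hk hkd))

/-- On the orthant, the sup-norm distance to `axesUnion d (k - 1)` is the `k`-th order statistic:
replacing by `0` the components that do not exceed it gives a nearest point. -/
theorem boundedAway_axesUnion_iff (hk : 1 ≤ k) (hkd : k ≤ d) {B : Set (Fin d → ℝ)}
    (hB : B ⊆ orthant d) :
    BoundedAway B (axesUnion d (k - 1)) ↔ ∃ ε : ℝ, 0 < ε ∧ ∀ v ∈ B, ε ≤ ordStat v k := by
  constructor
  · rintro ⟨ε, hε, h⟩
    refine ⟨ε, hε, fun v hv => ?_⟩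
    set x := ordStat v k with hx
    have hx0 : 0 ≤ x := ordStat_nonneg hk hkd (hB hv)
    set y : Fin d → ℝ := fun j => if x < v j then v j else 0 with hy
    have hyo : y ∈ orthant d := fun j => by
      simp only [hy]; split_ifs
      exacts [hB hv j, le_rfl]
    refine (h v hv y ⟨hyo, ?_⟩).trans ?_
    · rw [Nat.sub_add_cancel hk]
      by_contra hne
      have hpos := lt_of_le_of_ne (ordStat_nonneg hk hkd hyo) (Ne.symm hne)
      rw [lt_ordStat_iff hk hkd] at hpos
      refine lt_irrefl x ((lt_ordStat_iff hk hkd v x).2 (hpos.trans (Finset.card_le_card ?_)))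
      intro j
      simp only [Finset.mem_filter, Finset.mem_univ, true_and, hy]
      intro hj
      by_contra hcon
      simp [hcon] at hj
    · refine (dist_pi_le_iff hx0).2 fun j => ?_
      simp only [hy, Real.dist_eq]
      split_ifs with hj
      · simpa using hx0
      · rw [sub_zero, abs_of_nonneg (hB hv j)]
        exact not_lt.1 hj
  · rintro ⟨ε, hε, h⟩
    refine ⟨ε, hε, fun v hv y hy => (h v hv).trans ?_⟩
    have := abs_ordStat_sub_le hk hkd v y
    have hy0 := hy.2
    rw [Nat.sub_add_cancel hk] at hy0
    rw [hy0, sub_zero] at this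
    exact (le_abs_self _).trans this

end OrdStat

/-! ### Test functions -/

/-- Everywhere defined test functions for `M(E_d^{(i)})`: bounded continuous functions on `ℝ^d`
which, on the orthant, vanish near the set where the `i`-th order statistic is zero. -/
structure IsTest (d i : ℕ) (F : (Fin d → ℝ) → ℝ) : Prop where
  continuous : Continuous F
  bounded : ∃ M : ℝ, ∀ z, |F z| ≤ M
  vanish : ∃ ε : ℝ, 0 < ε ∧ ∀ z ∈ orthant d, ordStat z i < ε → F z = 0

section Test

variable {d i : ℕ}

/-- A continuous function on the cone with support bounded away from the removed set is the
restriction of a test function: extend it by zero to the orthant, and then by the coordinatewise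
positive part to the whole space. -/
theorem exists_isTest_eqOn (hi : 1 ≤ i) (hid : i ≤ d) {f : (Fin d → ℝ) → ℝ}
    (hf : ContinuousOn f (orthant d \ axesUnion d (i - 1)))
    (hb : ∃ M : ℝ, ∀ x ∈ orthant d \ axesUnion d (i - 1), |f x| ≤ M)
    (hs : BoundedAway {x ∈ orthant d \ axesUnion d (i - 1) | f x ≠ 0} (axesUnion d (i - 1))) :
    ∃ F, IsTest d i F ∧ EqOn f F (subcone d i) := by
  change ContinuousOn f (subcone d i) at hf
  change ∃ M : ℝ, ∀ x ∈ subcone d i, |f x| ≤ M at hb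
  change BoundedAway {x ∈ subcone d i | f x ≠ 0} _ at hs
  obtain ⟨ε, hε, hs⟩ := (boundedAway_axesUnion_iff hi hid
    (fun x hx => ((mem_subcone_iff hi hid).1 hx.1).1)).1 hs
  obtain ⟨M, hM⟩ := hb
  set g : (Fin d → ℝ) → ℝ := (subcone d i).indicator f with hg
  have hg0 : ∀ z, ordStat z i < ε → g z = 0 := by
    intro z hz
    by_cases hmem : z ∈ subcone d i
    · rw [hg, indicator_of_mem hmem]
      by_contra hne
      exact absurd (hs z ⟨hmem, hne⟩) (not_le.2 hz)
    · rw [hg, indicator_of_notMem hmem]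
  have hgc : ContinuousOn g (orthant d) := by
    intro z hz
    by_cases hzε : ordStat z i < ε
    · have hev : ∀ᶠ y in 𝓝 z, g y = 0 := by
        filter_upwards [(continuous_ordStat hi hid).continuousAt.eventually_lt
          continuousAt_const hzε] with y hy using hg0 y hy
      have : ContinuousAt g z :=
        (continuousAt_const (y := (0 : ℝ))).congr (hev.mono fun y hy => hy.symm)
      exact this.continuousWithinAt
    · have hzpos : 0 < ordStat z i := hε.trans_le (not_lt.1 hzε)
      have hmem : z ∈ subcone d i := (mem_subcone_iff hi hid).2 ⟨hz, hzpos⟩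
      have hnhds : subcone d i ∈ 𝓝[orthant d] z := by
        have h1 := (continuous_ordStat hi hid).continuousAt.eventually_const_lt hzpos
        filter_upwards [self_mem_nhdsWithin, nhdsWithin_le_nhds h1] with y hy hy'
        exact (mem_subcone_iff hi hid).2 ⟨hy, hy'⟩
      refine ((hf z hmem).mono_of_mem_nhdsWithin hnhds).congr_of_eventuallyEq ?_ ?_
      · filter_upwards [hnhds] with y hy using indicator_of_mem hy f
      · exact indicator_of_mem hmem f
  have hpos : ∀ z : Fin d → ℝ, z ⊔ 0 ∈ orthant d := fun z j => by simp
  have hid' : ∀ z ∈ orthant d, z ⊔ 0 = z := fun z hz => sup_eq_left.2 fun j => hz j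
  refine ⟨fun z => g (z ⊔ 0), ⟨?_, ⟨|M|, fun z => ?_⟩, ε, hε, fun z hz hzε => ?_⟩, fun z hz => ?_⟩
  · exact hgc.comp_continuous (continuous_pi fun j => (continuous_apply j).max continuous_const) hpos
  · by_cases hmem : z ⊔ 0 ∈ subcone d i
    · simp only [hg, indicator_of_mem hmem]
      exact (hM _ hmem).trans (le_abs_self M)
    · simp [hg, indicator_of_notMem hmem]
  · rw [hid' z hz]; exact hg0 z hzε
  · simp only
    rw [hid' z ((mem_subcone_iff hi hid).1 hz).1, hg, indicator_of_mem hz]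

theorem IsTest.eq_zero_of_notMem (hi : 1 ≤ i) (hid : i ≤ d) {F : (Fin d → ℝ) → ℝ}
    (hF : IsTest d i F) {z : Fin d → ℝ} (hz : z ∈ orthant d) (h : z ∉ subcone d i) : F z = 0 := by
  obtain ⟨ε, hε, hv⟩ := hF.vanish
  refine hv z hz (lt_of_not_ge fun h' => h ?_)
  exact (mem_subcone_iff hi hid).2 ⟨hz, hε.trans_le h'⟩

/-- A test function that is `1` where the `i`-th order statistic is at least `r` and `0` where it
is at most `r / 2`. -/
noncomputable def ramp (d i : ℕ) (r : ℝ) (z : Fin d → ℝ) : ℝ :=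
  max 0 (min 1 (2 / r * ordStat z i - 1))

theorem isTest_ramp (hi : 1 ≤ i) (hid : i ≤ d) {r : ℝ} (hr : 0 < r) : IsTest d i (ramp d i r) := by
  refine ⟨?_, ⟨1, fun z => ?_⟩, r / 2, by positivity, fun z _ hz => ?_⟩
  · have := continuous_ordStat hi hid
    unfold ramp
    fun_prop
  · unfold ramp
    rw [abs_of_nonneg (le_max_left _ _)]
    exact max_le zero_le_one (min_le_left _ _)
  · unfold ramp
    have : 2 / r * ordStat z i < 1 := by
      rw [div_mul_eq_mul_div, div_lt_one hr]; linarith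
    exact max_eq_left ((min_le_right _ _).trans (by linarith))

theorem ramp_nonneg (r : ℝ) (z : Fin d → ℝ) : 0 ≤ ramp d i r z := le_max_left _ _

theorem ramp_eq_one {r : ℝ} (hr : 0 < r) {z : Fin d → ℝ} (h : r ≤ ordStat z i) :
    ramp d i r z = 1 := by
  unfold ramp
  have : 1 ≤ 2 / r * ordStat z i - 1 := by
    have : 2 / r * r ≤ 2 / r * ordStat z i := by gcongr
    rw [div_mul_cancel₀ _ hr.ne'] at this
    linarith
  rw [min_eq_left this]; simp

/-- Measures in `M(E_d^{(i)})` integrate all test functions. -/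
theorem IsTest.integrable (hi : 1 ≤ i) (hid : i ≤ d) {F : (Fin d → ℝ) → ℝ} (hF : IsTest d i F)
    {μ : Measure (Fin d → ℝ)} (hμ : IsMMeasure (orthant d) (axesUnion d (i - 1)) μ) :
    Integrable F μ := by
  obtain ⟨M, hM⟩ := hF.bounded
  obtain ⟨ε, hε, hv⟩ := hF.vanish
  set B : Set (Fin d → ℝ) := orthant d ∩ {z | ε ≤ ordStat z i} with hB
  have hBm : MeasurableSet B :=
    measurableSet_orthant.inter (measurableSet_le measurable_const (measurable_ordStat hi hid))
  have hBfin : μ B < ∞ := by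
    refine hμ.finite B hBm (fun z hz => ?_) ?_
    · exact (mem_subcone_iff hi hid).2 ⟨hz.1, hε.trans_le hz.2⟩
    · exact (boundedAway_axesUnion_iff hi hid inter_subset_left).2 ⟨ε, hε, fun z hz => hz.2⟩
  have hint : Integrable (B.indicator fun _ => M) μ :=
    (integrable_indicator_iff hBm).2 (integrableOn_const hBfin.ne)
  have hae : ∀ᵐ z ∂μ, z ∈ subcone d i := hμ.carried
  refine hint.mono' hF.continuous.aestronglyMeasurable ?_
  filter_upwards [hae] with z hz
  by_cases hzB : z ∈ B
  · simpa [indicator_of_mem hzB] using hM z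
  · have hzo := ((mem_subcone_iff hi hid).1 hz).1
    have : F z = 0 := hv z hzo (lt_of_not_ge fun h => hzB ⟨hzo, h⟩)
    simp [indicator_of_notMem hzB, this]

end Test

theorem IsTest.setIntegral_smul_map {Ω : Type*} [MeasurableSpace Ω] {d i : ℕ} (hi : 1 ≤ i)
    (hid : i ≤ d) {F : (Fin d → ℝ) → ℝ} (hF : IsTest d i F) (Q : Measure Ω) {X : Ω → Fin d → ℝ}
    (hX : Measurable X) (hXo : ∀ᵐ ω ∂Q, X ω ∈ orthant d) (c : ℝ≥0∞) :
    ∫ z in subcone d i, F z ∂(c • (Q.map X).restrict (subcone d i)) =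
      c.toReal * ∫ ω, F (X ω) ∂Q := by
  have hS := measurableSet_subcone hi hid
  rw [Measure.restrict_smul, Measure.restrict_restrict hS, inter_self, integral_smul_measure,
    setIntegral_map hS hF.continuous.aestronglyMeasurable hX.aemeasurable, smul_eq_mul,
    setIntegral_eq_integral_of_ae_compl_eq_zero]
  filter_upwards [hXo] with ω hω h using hF.eq_zero_of_notMem hi hid hω h

theorem smul_mem_orthant {d : ℕ} {c : ℝ} (hc : 0 ≤ c) {z : Fin d → ℝ} (hz : z ∈ orthant d) :
    c • z ∈ orthant d := fun j => mul_nonneg hc (hz j)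

/-! ### Regularly varying scaling functions -/

section RegVar

variable {b : ℝ → ℝ} {α : ℝ}

theorem IsRegVarInv.eventually_pos (hb : IsRegVarInv b α) : ∀ᶠ t in atTop, 0 < b t := by
  rcases hb with ⟨_, h⟩ | ⟨_, h⟩ <;> exact h.1

theorem IsRegVarInv.nonneg (hb : IsRegVarInv b α) : 0 ≤ α := by
  rcases hb with ⟨h, _⟩ | ⟨h, _⟩
  exacts [h.le, h.ge]

/-- The one consequence of `b ∈ RV_{1/α}` that holds uniformly for `α > 0` and `α = 0`. -/
theorem IsRegVarInv.eventually_mul_lt (hb : IsRegVarInv b α) {x y : ℝ} (hx : 1 < x)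
    (hy : 0 < α → y < x ^ (1 / α)) : ∀ᶠ t in atTop, y * b t < b (t * x) := by
  have key : ∀ᶠ t in atTop, y < b (t * x) / b t := by
    rcases hb with ⟨hα, h⟩ | ⟨_, h⟩
    · exact (h.2 x (by linarith)).eventually_const_lt (hy hα)
    · exact (h.2 x hx).eventually_gt_atTop y
  filter_upwards [key, hb.eventually_pos] with t h1 h2
  rwa [lt_div_iff₀ h2] at h1

/-- Iterating `y * b t < b (t * 2)` with some `y > 1` shows that `b` is unbounded. -/
theorem IsRegVarInv.exists_lt (hb : IsRegVarInv b α) (x t₀ : ℝ) : ∃ t, t₀ < t ∧ x < b t := by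
  obtain ⟨y, hy1, hy⟩ : ∃ y : ℝ, 1 < y ∧ (0 < α → y < 2 ^ (1 / α)) := by
    by_cases hα : 0 < α
    · obtain ⟨y, h1, h2⟩ := exists_between
        (Real.one_lt_rpow (x := 2) one_lt_two (z := 1 / α) (by positivity))
      exact ⟨y, h1, fun _ => h2⟩
    · exact ⟨2, one_lt_two, fun h => absurd h hα⟩
  obtain ⟨T, hT⟩ := eventually_atTop.1
    ((hb.eventually_mul_lt one_lt_two hy).and hb.eventually_pos)
  set T' := max T (max 1 (t₀ + 1)) with hT'
  have hT1 : T ≤ T' := le_max_left _ _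
  have hT2 : 1 ≤ T' := (le_max_left _ _).trans (le_max_right _ _)
  have hT3 : t₀ + 1 ≤ T' := (le_max_right _ _).trans (le_max_right _ _)
  have hpow : ∀ n : ℕ, T' ≤ T' * 2 ^ n := fun n =>
    le_mul_of_one_le_right (by linarith) (one_le_pow₀ one_le_two)
  have hgrow : ∀ n : ℕ, y ^ n * b T' ≤ b (T' * 2 ^ n) := by
    intro n
    induction n with
    | zero => simp
    | succ n ih =>
      have := (hT (T' * 2 ^ n) (hT1.trans (hpow n))).1
      calc y ^ (n + 1) * b T' = y * (y ^ n * b T') := by ring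
        _ ≤ y * b (T' * 2 ^ n) := by gcongr
        _ ≤ b (T' * 2 ^ n * 2) := this.le
        _ = b (T' * 2 ^ (n + 1)) := by ring_nf
  have hbT : 0 < b T' := (hT T' hT1).2
  obtain ⟨n, hn⟩ := pow_unbounded_of_one_lt (x / b T') hy1
  refine ⟨T' * 2 ^ n, by linarith [hpow n], lt_of_lt_of_le ?_ (hgrow n)⟩
  rwa [div_lt_iff₀ hbT] at hn

end RegVar

/-! ### The tail of the radial part -/

/-- The tail function `s ↦ P (Z^{(i)} > s)`. -/
noncomputable def tail {Ω : Type*} [MeasurableSpace Ω] (P : Measure Ω) {d : ℕ}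
    (Z : Ω → Fin d → ℝ) (i : ℕ) (s : ℝ) : ℝ :=
  P.real {ω | s < ordStat (Z ω) i}

section Tail

variable {Ω : Type*} [MeasurableSpace Ω] {P : Measure Ω} {d i : ℕ} {Z : Ω → Fin d → ℝ} {α : ℝ}

theorem tail_nonneg (s : ℝ) : 0 ≤ tail P Z i s := measureReal_nonneg

variable [IsProbabilityMeasure P]

theorem tail_le_one (s : ℝ) : tail P Z i s ≤ 1 := measureReal_le_one

theorem tail_antitone : Antitone (tail P Z i) := fun _ _ hst =>
  measureReal_mono fun _ hω => lt_of_le_of_lt hst hω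

theorem real_ordStat_le (hi : 1 ≤ i) (hid : i ≤ d) (hZ : Measurable Z) (x : ℝ) :
    P.real {ω | ordStat (Z ω) i ≤ x} = 1 - tail P Z i x := by
  have hR : Measurable fun ω => ordStat (Z ω) i := (measurable_ordStat hi hid).comp hZ
  rw [tail, ← probReal_compl_eq_one_sub (measurableSet_lt measurable_const hR)]
  congr 1
  ext ω
  simp

theorem tendsto_tail (hi : 1 ≤ i) (hid : i ≤ d) (hZ : Measurable Z) :
    Tendsto (tail P Z i) atTop (𝓝 0) := by
  have hR : Measurable fun ω => ordStat (Z ω) i := (measurable_ordStat hi hid).comp hZ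
  have : IsProbabilityMeasure (P.map fun ω => ordStat (Z ω) i) :=
    Measure.isProbabilityMeasure_map hR.aemeasurable
  have h := (tendsto_cdf_atTop (P.map fun ω => ordStat (Z ω) i)).const_sub 1
  rw [sub_self] at h
  refine h.congr fun x => ?_
  rw [cdf_eq_real, map_measureReal_apply hR measurableSet_Iic]
  change 1 - P.real {ω | ordStat (Z ω) i ≤ x} = _
  rw [real_ordStat_le hi hid hZ]
  ring

/-- One half of the characterisation of `canonicalScaling` as the left-continuous inverse of
`1 / tail`; the other half is `tail_le_of_canonicalScaling_lt`. -/
theorem canonicalScaling_le_of_tail_le (hi : 1 ≤ i) (hid : i ≤ d) (hZ : Measurable Z)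
    (hZo : ∀ ω, Z ω ∈ orthant d) {t x : ℝ} (ht : 1 < t) (h : tail P Z i x ≤ 1 / t) :
    canonicalScaling P Z i t ≤ x := by
  refine csInf_le ⟨0, fun y hy => ?_⟩ ?_
  · by_contra hneg
    have : {ω | ordStat (Z ω) i ≤ y} = ∅ := by
      ext ω
      simp only [mem_ofPred_eq, mem_empty_iff_false, iff_false, not_le]
      exact (not_le.1 hneg).trans_le (ordStat_nonneg hi hid (hZo ω))
    have hy' : P.real {ω | ordStat (Z ω) i ≤ y} ≥ 1 - 1 / t := hy
    rw [this, measureReal_empty] at hy'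
    have : 1 / t < 1 := by rw [div_lt_one] <;> linarith
    linarith
  · change P.real {ω | ordStat (Z ω) i ≤ x} ≥ 1 - 1 / t
    rw [real_ordStat_le hi hid hZ]
    linarith

theorem tail_le_of_canonicalScaling_lt (hi : 1 ≤ i) (hid : i ≤ d) (hZ : Measurable Z)
    {t x : ℝ} (ht : 0 < t) (h : canonicalScaling P Z i t < x) : tail P Z i x ≤ 1 / t := by
  have hne : {x : ℝ | P.real {ω | ordStat (Z ω) i ≤ x} ≥ 1 - 1 / t}.Nonempty := by
    obtain ⟨y, hy⟩ := ((tendsto_tail (P := P) hi hid hZ).eventually_le_const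
      (show (0 : ℝ) < 1 / t by positivity)).exists
    refine ⟨y, ?_⟩
    change P.real {ω | ordStat (Z ω) i ≤ y} ≥ 1 - 1 / t
    rw [real_ordStat_le hi hid hZ]
    linarith
  obtain ⟨y, hy, hyx⟩ := exists_lt_of_csInf_lt hne h
  have hy' : P.real {ω | ordStat (Z ω) i ≤ y} ≥ 1 - 1 / t := hy
  rw [real_ordStat_le hi hid hZ] at hy'
  have := tail_antitone (P := P) (Z := Z) (i := i) hyx.le
  linarith

theorem tail_pos (hi : 1 ≤ i) (hid : i ≤ d) (hZ : Measurable Z) (hZo : ∀ ω, Z ω ∈ orthant d)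
    (hb : IsRegVarInv (canonicalScaling P Z i) α) (s : ℝ) : 0 < tail P Z i s := by
  obtain ⟨t, ht, hs⟩ := hb.exists_lt s 1
  by_contra hneg
  refine absurd hs (not_lt.2 (canonicalScaling_le_of_tail_le hi hid hZ hZo ht ?_))
  exact (not_lt.1 hneg).trans (by positivity)

theorem tendsto_inv_tail (hi : 1 ≤ i) (hid : i ≤ d) (hZ : Measurable Z)
    (hZo : ∀ ω, Z ω ∈ orthant d) (hb : IsRegVarInv (canonicalScaling P Z i) α) :
    Tendsto (fun s => (tail P Z i s)⁻¹) atTop atTop :=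
  tendsto_inv_nhdsGT_zero.comp (tendsto_nhdsWithin_iff.2
    ⟨tendsto_tail hi hid hZ, Eventually.of_forall fun s => tail_pos hi hid hZ hZo hb s⟩)

/-- A Potter bound for the tail, valid also when `t / u` is small. The argument only uses the
behaviour of `canonicalScaling` along `t ↦ t / 2 ^ p`, which for every `p > α` gives
`tail (s / 2) ≤ 2 ^ p * tail s` for all large `s`, whether the scaling varies regularly or
rapidly. -/
theorem exists_tail_div_le (hi : 1 ≤ i) (hid : i ≤ d) (hZ : Measurable Z)
    (hZo : ∀ ω, Z ω ∈ orthant d) (hb : IsRegVarInv (canonicalScaling P Z i) α) {p : ℝ}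
    (hp : α < p) :
    ∃ C t₀ : ℝ, 0 < C ∧ ∀ t, t₀ ≤ t → ∀ u, 1 ≤ u →
      tail P Z i (t / u) ≤ C * u ^ p * tail P Z i t := by
  have hp0 : 0 < p := hb.nonneg.trans_lt hp
  set G := tail P Z i with hG
  set K : ℝ := 2 ^ p with hK
  have hK1 : 1 < K := Real.one_lt_rpow one_lt_two hp0
  have hK0 : 0 < K := by linarith
  have hstep : ∀ᶠ s in atTop, G (s / 2) ≤ K * G s := by
    have h1 : ∀ᶠ t in atTop, 2 * canonicalScaling P Z i t < canonicalScaling P Z i (t * K) := by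
      refine hb.eventually_mul_lt hK1 fun hα => ?_
      rw [hK, ← Real.rpow_mul zero_le_two]
      calc (2 : ℝ) = 2 ^ (1 : ℝ) := (Real.rpow_one 2).symm
        _ < 2 ^ (p * (1 / α)) := by
          refine Real.rpow_lt_rpow_of_exponent_lt one_lt_two ?_
          rwa [mul_one_div, one_lt_div hα]
    have hlim := tendsto_inv_tail hi hid hZ hZo hb
    filter_upwards [(hlim.atTop_div_const hK0).eventually h1, hlim.eventually_gt_atTop 1]
      with s hs ht
    have hpos := tail_pos hi hid hZ hZo hb s
    rw [div_mul_cancel₀ _ hK0.ne'] at hs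
    have hle : canonicalScaling P Z i (tail P Z i s)⁻¹ ≤ s :=
      canonicalScaling_le_of_tail_le hi hid hZ hZo ht (by simp)
    have := tail_le_of_canonicalScaling_lt (P := P) hi hid hZ (t := (tail P Z i s)⁻¹ / K) (x := s / 2)
      (by positivity) (by linarith)
    rwa [one_div, inv_div, div_inv_eq_mul] at this
  obtain ⟨s₁, hs₁⟩ := eventually_atTop.1 hstep
  set s₀ := max s₁ 1 with hs₀
  have hs₀pos : 0 < s₀ := lt_of_lt_of_le one_pos (le_max_right _ _)
  have hiter : ∀ (n : ℕ) (s : ℝ), s₀ * 2 ^ n ≤ s → G (s / 2 ^ (n + 1)) ≤ K ^ (n + 1) * G s := by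
    intro n
    induction n with
    | zero => intro s hs; simpa using hs₁ s ((le_max_left s₁ 1).trans (by simpa only [pow_zero, mul_one] using hs))
    | succ n ih =>
      intro s hs
      have h2 : s₀ * 2 ^ n ≤ s / 2 := by
        rw [le_div_iff₀ two_pos]; calc _ = s₀ * 2 ^ (n + 1) := by ring
          _ ≤ s := hs
      have h3 : s₁ ≤ s := by
        refine (le_max_left s₁ 1).trans ((le_mul_of_one_le_right hs₀pos.le ?_).trans hs)
        exact one_le_pow₀ one_le_two
      calc G (s / 2 ^ (n + 1 + 1)) = G (s / 2 / 2 ^ (n + 1)) := by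
            rw [div_div, ← pow_succ']
        _ ≤ K ^ (n + 1) * G (s / 2) := ih _ h2
        _ ≤ K ^ (n + 1) * (K * G s) := by gcongr; exact hs₁ s h3
        _ = K ^ (n + 1 + 1) * G s := by ring
  have hG0 : 0 < G s₀ := tail_pos hi hid hZ hZo hb s₀
  refine ⟨K / G s₀, s₀, by positivity, fun t ht u hu => ?_⟩
  have htpos : 0 < t := hs₀pos.trans_le ht
  have hmin : 1 ≤ min u (t / s₀) := le_min hu ((one_le_div hs₀pos).2 ht)
  obtain ⟨m, hm1, hm2⟩ := exists_nat_pow_near hmin one_lt_two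
  have hmt : s₀ * 2 ^ m ≤ t := by
    have := hm1.trans (min_le_right _ _)
    rw [le_div_iff₀ hs₀pos] at this
    linarith
  -- Either `u < 2 ^ (m + 1)`, or `t / 2 ^ (m + 1) < s₀` and the trivial bound `G ≤ 1` suffices.
  have hcase : G (t / u) ≤ G (t / 2 ^ (m + 1)) / G s₀ := by
    rw [le_div_iff₀ hG0]
    rcases min_lt_iff.1 hm2 with h | h
    · calc G (t / u) * G s₀ ≤ G (t / u) * 1 :=
            mul_le_mul_of_nonneg_left (tail_le_one _) (tail_nonneg _)
        _ ≤ G (t / 2 ^ (m + 1)) := by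
          rw [mul_one]; exact tail_antitone (by gcongr)
    · calc G (t / u) * G s₀ ≤ 1 * G s₀ :=
            mul_le_mul_of_nonneg_right (tail_le_one _) (tail_nonneg _)
        _ ≤ G (t / 2 ^ (m + 1)) := by
          rw [one_mul]
          refine tail_antitone ?_
          rw [div_lt_iff₀ hs₀pos] at h
          rw [div_le_iff₀ (by positivity)]
          linarith
  have hKu : K ^ m ≤ u ^ p := by
    rw [hK, ← Real.rpow_natCast, ← Real.rpow_mul zero_le_two, mul_comm p, Real.rpow_mul zero_le_two,
      Real.rpow_natCast]
    exact Real.rpow_le_rpow (by positivity) (hm1.trans (min_le_left _ _)) hp0.le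
  calc G (t / u) ≤ G (t / 2 ^ (m + 1)) / G s₀ := hcase
    _ ≤ K ^ (m + 1) * G t / G s₀ := by gcongr; exact hiter m t hmt
    _ = K / G s₀ * K ^ m * G t := by ring
    _ ≤ K / G s₀ * u ^ p * G t := by
      have := tail_nonneg (P := P) (Z := Z) (i := i) t
      gcongr

end Tail

/-! ### Convergence along the continuous parameter -/

/-- The oscillation of `F` at `z` along the ray through `z`, over the scales in `[1 - ε, 1]`. -/
noncomputable def radialOsc {d : ℕ} (F : (Fin d → ℝ) → ℝ) (ε : ℝ) (z : Fin d → ℝ) : ℝ :=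
  sSup ((fun c : ℝ => |F (c • z) - F z|) '' Icc (1 - ε) 1)

section RadialOsc

variable {d i : ℕ} {F : (Fin d → ℝ) → ℝ}

theorem IsTest.bddAbove_radialOsc (hF : IsTest d i F) (ε : ℝ) (z : Fin d → ℝ) :
    BddAbove ((fun c : ℝ => |F (c • z) - F z|) '' Icc (1 - ε) 1) := by
  have := hF.continuous
  exact isCompact_Icc.bddAbove_image (by fun_prop)

theorem IsTest.abs_sub_le_radialOsc (hF : IsTest d i F) {ε c : ℝ} (hc : c ∈ Icc (1 - ε) 1)
    (z : Fin d → ℝ) : |F (c • z) - F z| ≤ radialOsc F ε z :=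
  le_csSup (hF.bddAbove_radialOsc ε z) ⟨c, hc, rfl⟩

theorem IsTest.radialOsc_nonneg (hF : IsTest d i F) {ε : ℝ} (hε : 0 ≤ ε) (z : Fin d → ℝ) :
    0 ≤ radialOsc F ε z :=
  (abs_nonneg _).trans (hF.abs_sub_le_radialOsc ⟨by linarith, le_rfl⟩ z)

theorem IsTest.radialOsc_mono (hF : IsTest d i F) {ε ε' : ℝ} (hε : 0 ≤ ε) (h : ε ≤ ε')
    (z : Fin d → ℝ) : radialOsc F ε z ≤ radialOsc F ε' z :=
  csSup_le_csSup (hF.bddAbove_radialOsc ε' z) ((nonempty_Icc.2 (by linarith)).image _)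
    (image_mono (Icc_subset_Icc_left (by linarith)))

theorem isTest_radialOsc (hi : 1 ≤ i) (hid : i ≤ d) (hF : IsTest d i F) {ε : ℝ} (hε : 0 ≤ ε)
    (hε1 : ε < 1) : IsTest d i (radialOsc F ε) := by
  have hFc := hF.continuous
  obtain ⟨M, hM⟩ := hF.bounded
  obtain ⟨r, hr, hv⟩ := hF.vanish
  have hne : (Icc (1 - ε) 1).Nonempty := nonempty_Icc.2 (by linarith)
  refine ⟨?_, ⟨2 * M, fun z => ?_⟩, r, hr, fun z hz hzr => ?_⟩
  · refine isCompact_Icc.continuous_sSup (f := fun z c => |F (c • z) - F z|) ?_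
    simp only [Function.HasUncurry.uncurry, id]
    fun_prop
  · rw [abs_of_nonneg (hF.radialOsc_nonneg hε z)]
    refine csSup_le (hne.image _) ?_
    rintro _ ⟨c, _, rfl⟩
    have := abs_sub (F (c • z)) (F z)
    linarith [hM (c • z), hM z]
  · have h0 : ∀ c ∈ Icc (1 - ε) 1, |F (c • z) - F z| = 0 := by
      rintro c ⟨hc, hc1⟩
      have hc0 : 0 < c := by linarith
      have hz0 := ordStat_nonneg hi hid hz
      rw [hv z hz hzr, hv (c • z) (smul_mem_orthant hc0.le hz), sub_zero, abs_zero]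
      rw [ordStat_smul hi hid hc0]
      nlinarith
    unfold radialOsc
    rw [image_congr h0, hne.image_const, csSup_singleton]

theorem IsTest.tendsto_integral_radialOsc (hi : 1 ≤ i) (hid : i ≤ d) (hF : IsTest d i F)
    {μ : Measure (Fin d → ℝ)} (hμ : IsMMeasure (orthant d) (axesUnion d (i - 1)) μ) :
    Tendsto (fun n : ℕ => ∫ z, radialOsc F (1 / ((n + 1 : ℕ) + 1 : ℝ)) z ∂μ) atTop (𝓝 0) := by
  have hFc := hF.continuous
  have hlt : ∀ n : ℕ, (1 : ℝ) / ((n + 1 : ℕ) + 1 : ℝ) ≤ 1 / 2 := fun n => by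
    push_cast
    exact one_div_le_one_div_of_le two_pos (by linarith [(Nat.cast_nonneg n : (0 : ℝ) ≤ n)])
  have hpos : ∀ n : ℕ, (0 : ℝ) ≤ 1 / ((n + 1 : ℕ) + 1 : ℝ) := fun n => by positivity
  have htest : ∀ n : ℕ, IsTest d i (radialOsc F (1 / ((n + 1 : ℕ) + 1 : ℝ))) := fun n =>
    isTest_radialOsc hi hid hF (hpos n) (lt_of_le_of_lt (hlt n) (by norm_num))
  have hdom := (isTest_radialOsc hi hid hF (ε := 1 / 2) (by norm_num) (by norm_num)).integrable
    hi hid hμ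
  rw [← integral_zero (Fin d → ℝ) ℝ (μ := μ)]
  refine tendsto_integral_of_dominated_convergence _
    (fun n => (htest n).continuous.aestronglyMeasurable) hdom
    (fun n => Eventually.of_forall fun z => ?_) (Eventually.of_forall fun z => ?_)
  · rw [Real.norm_of_nonneg (hF.radialOsc_nonneg (hpos n) z)]
    exact hF.radialOsc_mono (hpos n) (hlt n) z
  · have hcont : Continuous fun c : ℝ => F (c • z) := by fun_prop
    refine Metric.tendsto_atTop.2 fun η hη => ?_
    obtain ⟨r, hr, hr'⟩ := Metric.continuousAt_iff.1 (hcont.continuousAt (x := 1)) (η / 2)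
      (half_pos hη)
    have hlim := (tendsto_one_div_add_atTop_nhds_zero_nat (𝕜 := ℝ)).comp (tendsto_add_atTop_nat 1)
    obtain ⟨N, hN⟩ := eventually_atTop.1 (hlim.eventually_lt_const hr)
    refine ⟨N, fun n hn => ?_⟩
    have hn' : (1 : ℝ) / ((n + 1 : ℕ) + 1 : ℝ) < r := hN n hn
    rw [Real.dist_eq, sub_zero, abs_of_nonneg (hF.radialOsc_nonneg (hpos n) z)]
    refine lt_of_le_of_lt (csSup_le ((nonempty_Icc.2 (by linarith [hpos n])).image _) ?_)
      (half_lt_self hη)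
    rintro _ ⟨c, ⟨hc, hc1⟩, rfl⟩
    have := hr' (x := c) (by rw [Real.dist_eq, abs_lt]; constructor <;> linarith)
    rw [Real.dist_eq, one_smul] at this
    exact this.le

end RadialOsc

section Convergence

variable {Ω : Type*} [MeasurableSpace Ω] {P : Measure Ω} {d i : ℕ}
  {Z : Ω → Fin d → ℝ} {α : ℝ} {μ : Measure (Fin d → ℝ)} {F : (Fin d → ℝ) → ℝ}

theorem IsTest.integrable_comp_smul [IsFiniteMeasure P] (hF : IsTest d i F) (hZ : Measurable Z) (c : ℝ) :
    Integrable (fun ω => F (c • Z ω)) P := by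
  obtain ⟨M, hM⟩ := hF.bounded
  exact Integrable.of_bound
    (hF.continuous.measurable.comp (hZ.const_smul c)).aestronglyMeasurable M
    (Eventually.of_forall fun ω => hM _)

/-- Regular variation in terms of everywhere defined test functions and expectations. -/
theorem IsMRV.tendsto_test (hi : 1 ≤ i) (hid : i ≤ d)
    (hZ : IsMRV P Z α (canonicalScaling P Z i) μ (orthant d) (axesUnion d (i - 1)))
    (hF : IsTest d i F) :
    Tendsto (fun t => t * ∫ ω, F ((canonicalScaling P Z i t)⁻¹ • Z ω) ∂P) atTop
      (𝓝 (∫ z, F z ∂μ)) := by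
  obtain ⟨M, hM⟩ := hF.bounded
  have hae : ∀ᵐ z ∂μ, z ∈ subcone d i := hZ.tendsto.limit_mem.carried
  have hba : BoundedAway {x ∈ orthant d \ axesUnion d (i - 1) | F x ≠ 0}
      (axesUnion d (i - 1)) := by
    obtain ⟨r, hr, hv⟩ := hF.vanish
    refine (boundedAway_axesUnion_iff hi hid fun x hx => hx.1.1).2 ⟨r, hr, fun z hz => ?_⟩
    exact not_lt.1 fun h => hz.2 (hv z hz.1.1 h)
  have h := hZ.tendsto.tendsto_integral F hF.continuous.continuousOn ⟨M, fun x _ => hM x⟩ hba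
  rw [Measure.restrict_eq_self_of_ae_mem (s := orthant d \ axesUnion d (i - 1)) hae] at h
  refine h.congr' ?_
  filter_upwards [hZ.scaling.eventually_pos, eventually_ge_atTop 0] with t ht ht0
  have := hF.setIntegral_smul_map hi hid P
    (X := fun ω => (canonicalScaling P Z i t)⁻¹ • Z ω) (hZ.measurable.const_smul (canonicalScaling P Z i t)⁻¹)
    (ae_of_all _ fun ω => smul_mem_orthant (inv_nonneg.2 ht.le) (hZ.mem_cone ω)) (ENNReal.ofReal t)
  rw [ENNReal.toReal_ofReal ht0] at this
  exact this

variable [IsProbabilityMeasure P]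

/-- The index is positive: for a rapidly varying scaling function all the mass would escape to
infinity and the limit measure could not be finite away from the removed set. -/
theorem IsMRV.index_pos (hi : 1 ≤ i) (hid : i ≤ d)
    (hZ : IsMRV P Z α (canonicalScaling P Z i) μ (orthant d) (axesUnion d (i - 1))) :
    0 < α := by
  refine lt_of_le_of_ne hZ.scaling.nonneg fun hα => ?_
  have hμ := hZ.tendsto.limit_mem
  have hlow : ∀ n : ℕ, 1 / 2 ≤ ∫ z, ramp d i (n + 1 : ℝ) z ∂μ := by
    intro n
    have hn : (0 : ℝ) < n + 1 := by positivity
    have hF := isTest_ramp hi hid hn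
    refine ge_of_tendsto (hZ.tendsto_test hi hid hF) ?_
    filter_upwards [hZ.scaling.eventually_mul_lt (x := 2) (y := n + 1) one_lt_two
      (fun h => absurd hα h.ne), hZ.scaling.eventually_pos, eventually_gt_atTop 1]
      with t h1 h2 h3
    set c := canonicalScaling P Z i t with hc
    have h4 : 1 / (t * 2) < tail P Z i ((n + 1) * c) := by
      by_contra hcon
      exact absurd h1 (not_lt.2 (canonicalScaling_le_of_tail_le hi hid hZ.measurable hZ.mem_cone
        (by linarith) (not_lt.1 hcon)))
    have hm : MeasurableSet {ω | (n + 1) * c < ordStat (Z ω) i} :=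
      measurableSet_lt measurable_const ((measurable_ordStat hi hid).comp hZ.measurable)
    have h5 : tail P Z i ((n + 1) * c) ≤ ∫ ω, ramp d i (n + 1 : ℝ) (c⁻¹ • Z ω) ∂P := by
      rw [tail, ← integral_indicator_one hm]
      refine integral_mono ((integrable_const (1 : ℝ)).indicator hm)
        (hF.integrable_comp_smul hZ.measurable _) fun ω => ?_
      by_cases hω : ω ∈ {ω | (n + 1) * c < ordStat (Z ω) i}
      · rw [indicator_of_mem hω, ramp_eq_one hn]
        · rfl
        · rw [ordStat_smul hi hid (inv_pos.2 h2), inv_mul_eq_div, le_div_iff₀ h2]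
          exact le_of_lt hω
      · rw [indicator_of_notMem hω]
        exact ramp_nonneg _ _
    calc (1 : ℝ) / 2 = t * (1 / (t * 2)) := by field_simp
      _ ≤ t * ∫ ω, ramp d i (n + 1 : ℝ) (c⁻¹ • Z ω) ∂P := by gcongr; linarith
  have hlim : Tendsto (fun n : ℕ => ∫ z, ramp d i (n + 1 : ℝ) z ∂μ) atTop
      (𝓝 (∫ _, (0 : ℝ) ∂μ)) := by
    have hdom := (isTest_ramp hi hid (one_pos (α := ℝ))).integrable hi hid hμ
    have hae : ∀ᵐ z ∂μ, z ∈ subcone d i := hμ.carried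
    refine tendsto_integral_of_dominated_convergence _
      (fun n => (isTest_ramp hi hid (by positivity)).continuous.aestronglyMeasurable) hdom
      (fun n => ?_) (Eventually.of_forall fun z => ?_)
    · filter_upwards [hae] with z hz
      have hz0 := ((mem_subcone_iff hi hid).1 hz).2
      rw [Real.norm_of_nonneg (ramp_nonneg _ _)]
      unfold ramp
      have : (2 : ℝ) / (n + 1) ≤ 2 / 1 := by
        gcongr
        linarith [(Nat.cast_nonneg n : (0 : ℝ) ≤ n)]
      gcongr
    · refine tendsto_const_nhds.congr' ?_
      filter_upwards [eventually_ge_atTop ⌈2 * ordStat z i⌉₊] with n hn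
      have h1 : 2 * ordStat z i ≤ n := Nat.ceil_le.1 hn
      unfold ramp
      refine (max_eq_left ((min_le_right _ _).trans ?_)).symm
      rw [div_mul_eq_mul_div, sub_nonpos, div_le_one (by positivity)]
      linarith
  have := ge_of_tendsto' hlim hlow
  rw [integral_zero] at this
  norm_num at this

/-- `canonicalScaling` inverts `1 / tail` asymptotically, although neither need be continuous. -/
theorem IsMRV.eventually_lt_canonicalScaling (hi : 1 ≤ i) (hid : i ≤ d)
    (hZ : IsMRV P Z α (canonicalScaling P Z i) μ (orthant d) (axesUnion d (i - 1))) {η : ℝ}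
    (hη0 : 0 < η) (hη : η < 1) :
    ∀ᶠ s in atTop, η * s < canonicalScaling P Z i (tail P Z i s)⁻¹ := by
  have hα := hZ.index_pos hi hid
  have hrv : IsRegVar (canonicalScaling P Z i) (1 / α) := by
    rcases hZ.scaling with ⟨_, h⟩ | ⟨h, _⟩
    exacts [h, absurd h hα.ne']
  obtain ⟨y, hy1, hy⟩ := exists_between ((one_lt_inv₀ hη0).2 hη)
  set x : ℝ := y ^ α with hx
  have hx1 : 1 < x := Real.one_lt_rpow hy1 hα
  have hxy : x ^ (1 / α) < η⁻¹ := by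
    rwa [hx, ← Real.rpow_mul (by linarith), mul_one_div_cancel hα.ne', Real.rpow_one]
  have hlim := tendsto_inv_tail hi hid hZ.measurable hZ.mem_cone hZ.scaling
  filter_upwards [hlim.eventually ((hrv.2 x (by linarith)).eventually_lt_const hxy),
    hlim.eventually hrv.1, hlim.eventually_gt_atTop 1] with s h1 h2 h3
  have hG := tail_pos hi hid hZ.measurable hZ.mem_cone hZ.scaling s
  rw [div_lt_iff₀ h2] at h1
  have h4 : s ≤ canonicalScaling P Z i ((tail P Z i s)⁻¹ * x) := by
    by_contra hcon
    have h5 := tail_le_of_canonicalScaling_lt (P := P) hi hid hZ.measurable (by positivity)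
      (not_le.1 hcon)
    rw [one_div, mul_inv, inv_inv] at h5
    exact absurd h5 (not_le.2 (mul_lt_of_lt_one_right hG (inv_lt_one_of_one_lt₀ hx1)))
  have h6 := h4.trans_lt h1
  rwa [inv_mul_eq_div, lt_div_iff₀ hη0, mul_comm] at h6

/-- Regular variation with the tail of the radial part as normalisation: with `t = 1 / tail s`, the
factor `canonicalScaling t / s` tends to `1`, and `radialOsc` controls the effect of this
rescaling uniformly. -/
theorem IsMRV.tendsto_integral_div_tail (hi : 1 ≤ i) (hid : i ≤ d)
    (hZ : IsMRV P Z α (canonicalScaling P Z i) μ (orthant d) (axesUnion d (i - 1)))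
    (hF : IsTest d i F) :
    Tendsto (fun s => (tail P Z i s)⁻¹ * ∫ ω, F (s⁻¹ • Z ω) ∂P) atTop (𝓝 (∫ z, F z ∂μ)) := by
  have hμ := hZ.tendsto.limit_mem
  have hlim := tendsto_inv_tail hi hid hZ.measurable hZ.mem_cone hZ.scaling
  have h1 := (hZ.tendsto_test hi hid hF).comp hlim
  suffices h : Tendsto (fun s => (tail P Z i s)⁻¹ * ∫ ω, F (s⁻¹ • Z ω) ∂P -
      (tail P Z i s)⁻¹ *
        ∫ ω, F ((canonicalScaling P Z i (tail P Z i s)⁻¹)⁻¹ • Z ω) ∂P) atTop (𝓝 0) by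
    have h2 := h.add h1
    rw [zero_add] at h2
    refine h2.congr fun s => ?_
    simp only [Function.comp]
    ring
  refine Metric.tendsto_nhds.2 fun η hη => ?_
  obtain ⟨n, hn⟩ := ((hF.tendsto_integral_radialOsc hi hid hμ).eventually_lt_const hη).exists
  set ε : ℝ := 1 / ((n + 1 : ℕ) + 1 : ℝ) with hε
  have hε0 : 0 < ε := by positivity
  have hε1 : ε < 1 := by
    rw [hε, div_lt_one (by positivity)]
    push_cast
    linarith [(Nat.cast_nonneg n : (0 : ℝ) ≤ n)]
  have hO := isTest_radialOsc hi hid hF hε0.le hε1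
  have h2 := ((hZ.tendsto_test hi hid hO).comp hlim).eventually_lt_const hn
  filter_upwards [h2, hZ.eventually_lt_canonicalScaling hi hid (η := 1 - ε) (by linarith)
    (by linarith), hlim.eventually_gt_atTop 1, hlim.eventually hZ.scaling.eventually_pos,
    eventually_gt_atTop 0] with s h2 h3 h4 h5 hs
  have hle : canonicalScaling P Z i (tail P Z i s)⁻¹ ≤ s :=
    canonicalScaling_le_of_tail_le hi hid hZ.measurable hZ.mem_cone h4 (by simp)
  simp only [Function.comp] at h2
  set t := (tail P Z i s)⁻¹ with ht
  set b := canonicalScaling P Z i t with hb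
  have ht0 : 0 < t := by linarith
  have hc : b / s ∈ Icc (1 - ε) 1 :=
    ⟨by rw [le_div_iff₀ hs]; exact h3.le, (div_le_one hs).2 hle⟩
  rw [dist_zero_right, ← mul_sub, norm_mul, Real.norm_of_nonneg ht0.le,
    ← integral_sub (hF.integrable_comp_smul hZ.measurable _)
      (hF.integrable_comp_smul hZ.measurable _)]
  refine lt_of_le_of_lt (mul_le_mul_of_nonneg_left ?_ ht0.le) h2
  refine norm_integral_le_of_norm_le (hO.integrable_comp_smul hZ.measurable _)
    (Eventually.of_forall fun ω => ?_)
  have h6 := hF.abs_sub_le_radialOsc hc (b⁻¹ • Z ω)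
  rw [smul_smul, div_mul_eq_mul_div, mul_inv_cancel₀ h5.ne', one_div] at h6
  exact h6

end Convergence

/-! ### Nonnegative matrices -/

section Matrices

variable {q d k i : ℕ}

theorem mulVec_mem_orthant {a : Matrix (Fin q) (Fin d) ℝ} (ha : ∀ r c, 0 ≤ a r c)
    {z : Fin d → ℝ} (hz : z ∈ orthant d) : a *ᵥ z ∈ orthant q :=
  fun r => show 0 ≤ ∑ c, a r c * z c from
    Finset.sum_nonneg fun c _ => mul_nonneg (ha r c) (hz c)

/-- The inequality defining `matTau` extends by continuity from the subcone to the orthant. -/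
theorem ordStat_mulVec_le (hi : 1 ≤ i) (hid : i ≤ d) (hk : 1 ≤ k) (hkq : k ≤ q)
    {a : Matrix (Fin q) (Fin d) ℝ} (hτ : matTau a k i ≠ ∞) {z : Fin d → ℝ} (hz : z ∈ orthant d) :
    ordStat (a *ᵥ z) k ≤ (matTau a k i).toReal * ordStat z i := by
  have hsub : ∀ w ∈ subcone d i, ordStat (a *ᵥ w) k ≤ (matTau a k i).toReal * ordStat w i := by
    intro w hw
    have h : ENNReal.ofReal (ordStat (a *ᵥ w) k / ordStat w i) ≤ matTau a k i :=
      le_iSup₂_of_le w hw le_rfl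
    rwa [ENNReal.ofReal_le_iff_le_toReal hτ, div_le_iff₀ ((mem_subcone_iff hi hid).1 hw).2] at h
  have hci := continuous_ordStat hi hid
  have hck := continuous_ordStat hk hkq
  have hline : Continuous fun ε : ℝ => z + ε • (1 : Fin d → ℝ) := by fun_prop
  have hl : Continuous fun ε : ℝ => ordStat (a *ᵥ (z + ε • (1 : Fin d → ℝ))) k :=
    hck.comp (continuous_const.matrix_mulVec hline)
  have hr : Continuous fun ε : ℝ =>
      (matTau a k i).toReal * ordStat (z + ε • (1 : Fin d → ℝ)) i :=
    continuous_const.mul (hci.comp hline)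
  have h0 : z + (0 : ℝ) • (1 : Fin d → ℝ) = z := by simp
  have hl0 := (hl.tendsto 0).mono_left (nhdsWithin_le_nhds (s := Ioi 0))
  have hr0 := (hr.tendsto 0).mono_left (nhdsWithin_le_nhds (s := Ioi 0))
  rw [h0] at hl0 hr0
  refine le_of_tendsto_of_tendsto hl0 hr0 ?_
  filter_upwards [self_mem_nhdsWithin] with ε hε
  have hε' : (0 : ℝ) < ε := hε
  refine hsub _ ((mem_subcone_iff hi hid).2 ⟨fun j => ?_, lt_of_lt_of_le hε' ?_⟩)
  · have := hz j
    simp only [Pi.add_apply, Pi.smul_apply, Pi.one_apply, smul_eq_mul, mul_one]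
    linarith
  · rw [le_ordStat_iff hi hid, Finset.filter_true_of_mem]
    · simpa using hid
    · intro j _
      have := hz j
      simp only [Pi.add_apply, Pi.smul_apply, Pi.one_apply, smul_eq_mul, mul_one]
      linarith

theorem critIndex_eq_iff (hi : 1 ≤ i) (hid : i ≤ d) (a : Matrix (Fin q) (Fin d) ℝ) :
    critIndex a k = i ↔
      matTau a k i < ∞ ∧ ∀ j ∈ Finset.Ioc i d, ¬ matTau a k j < ∞ := by
  have hbdd : BddAbove {j : ℕ | 1 ≤ j ∧ j ≤ d ∧ matTau a k j < ∞} := ⟨d, fun j hj => hj.2.1⟩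
  constructor
  · intro h
    have hne : {j : ℕ | 1 ≤ j ∧ j ≤ d ∧ matTau a k j < ∞}.Nonempty := by
      by_contra hne
      rw [not_nonempty_iff_eq_empty] at hne
      rw [critIndex, hne, csSup_empty, Nat.bot_eq_zero] at h
      omega
    have hmem := Nat.sSup_mem hne hbdd
    rw [show sSup _ = i from h] at hmem
    refine ⟨hmem.2.2, fun j hj hfin => ?_⟩
    rw [Finset.mem_Ioc] at hj
    have : j ≤ critIndex a k := le_csSup hbdd ⟨by omega, hj.2, hfin⟩
    omega
  · rintro ⟨h1, h2⟩
    refine IsGreatest.csSup_eq ⟨⟨hi, hid, h1⟩, fun j hj => ?_⟩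
    by_contra hlt
    exact h2 j (Finset.mem_Ioc.2 ⟨by omega, hj.2.1⟩) hj.2.2

instance matrixBorelSpace : BorelSpace (Matrix (Fin q) (Fin d) ℝ) :=
  inferInstanceAs (BorelSpace (Fin q → Fin d → ℝ))

/-- As a supremum of continuous functions of the matrix, `matTau` is lower semicontinuous. -/
theorem measurable_matTau (hk : 1 ≤ k) (hkq : k ≤ q) (i : ℕ) :
    Measurable fun a : Matrix (Fin q) (Fin d) ℝ => matTau a k i := by
  refine LowerSemicontinuous.measurable ?_
  refine lowerSemicontinuous_biSup fun z _ => Continuous.lowerSemicontinuous ?_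
  exact ENNReal.continuous_ofReal.comp (((continuous_ordStat hk hkq).comp
    (continuous_id.matrix_mulVec continuous_const)).div_const _)

theorem measurableSet_critIndex_eq (hi : 1 ≤ i) (hid : i ≤ d) (hk : 1 ≤ k) (hkq : k ≤ q) :
    MeasurableSet {a : Matrix (Fin q) (Fin d) ℝ | critIndex a k = i} := by
  have : {a : Matrix (Fin q) (Fin d) ℝ | critIndex a k = i} =
      {a | matTau a k i < ∞} ∩ ⋂ j ∈ Finset.Ioc i d, {a | matTau a k j < ∞}ᶜ := by
    ext a
    simp only [mem_ofPred_eq, critIndex_eq_iff hi hid, mem_inter_iff, mem_iInter, mem_compl_iff]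
  rw [this]
  exact (measurableSet_lt (measurable_matTau hk hkq i) measurable_const).inter
    (Finset.measurableSet_biInter _ fun j _ =>
      (measurableSet_lt (measurable_matTau hk hkq j) measurable_const).compl)

open Classical in
/-- If every set of `i` columns leaves more than `q - k` rows untouched, then in these rows only
the components of `z` from the `(i+1)`-st largest on contribute, so `matTau a k (i + 1)` is
finite. -/
theorem matTau_succ_lt_top (hid : i + 1 ≤ d) (hk : 1 ≤ k) (hkq : k ≤ q)
    {a : Matrix (Fin q) (Fin d) ℝ} (ha : ∀ r c, 0 ≤ a r c)
    (h : ∀ J : Finset (Fin d), J.card = i →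
      (Finset.univ.filter fun r => ∃ j ∈ J, 0 < a r j).card < k) :
    matTau a k (i + 1) < ∞ := by
  have hi1 : 1 ≤ i + 1 := by omega
  refine lt_of_le_of_lt (iSup₂_le fun z hz => ?_)
    (ENNReal.ofReal_lt_top (r := ∑ r, ∑ j, a r j))
  obtain ⟨hzo, hz0⟩ := (mem_subcone_iff hi1 hid).1 hz
  refine ENNReal.ofReal_le_ofReal ?_
  rw [div_le_iff₀ hz0]
  set x := ordStat z (i + 1) with hx
  have hcard : (Finset.univ.filter fun j => x < z j).card ≤ i := by
    by_contra hcon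
    exact lt_irrefl x ((lt_ordStat_iff hi1 hid z x).2 (by omega))
  obtain ⟨J, hJ, hJc⟩ := Finset.exists_superset_card_eq hcard (by simp; omega)
  by_contra hcon
  rw [not_le, lt_ordStat_iff hk hkq] at hcon
  refine absurd (h J hJc) (not_lt.2 (hcon.trans (Finset.card_le_card fun r => ?_)))
  simp only [Finset.mem_filter, Finset.mem_univ, true_and]
  intro hr
  by_contra hno
  push Not at hno
  refine absurd hr (not_lt.2 ?_)
  calc (a *ᵥ z) r = ∑ j, a r j * z j := rfl
    _ ≤ ∑ j, a r j * x := Finset.sum_le_sum fun j _ => by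
        by_cases hj : j ∈ J
        · rw [le_antisymm (hno j hj) (ha r j), zero_mul, zero_mul]
        · refine mul_le_mul_of_nonneg_left ?_ (ha r j)
          exact not_lt.1 fun hlt => hj (hJ (by simpa using hlt))
    _ = (∑ j, a r j) * x := by rw [Finset.sum_mul]
    _ ≤ (∑ r, ∑ j, a r j) * x := by
        refine mul_le_mul_of_nonneg_right ?_ hz0.le
        exact Finset.single_le_sum (f := fun r => ∑ j, a r j)
          (fun r _ => Finset.sum_nonneg fun j _ => ha r j) (Finset.mem_univ r)

/-- By maximality of the critical index, some `i`-dimensional open face is mapped into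
`E_q^{(k)}`. -/
theorem exists_openFace_mapsTo (hi : 1 ≤ i) (hid : i ≤ d) (hk : 1 ≤ k) (hkq : k ≤ q)
    {a : Matrix (Fin q) (Fin d) ℝ} (ha : ∀ r c, 0 ≤ a r c) (hrow : ∀ r, a r ≠ 0)
    (hcrit : critIndex a k = i) :
    ∃ J : Finset (Fin d), J.card = i ∧ ∀ z ∈ openFace J, a *ᵥ z ∈ subcone q k := by
  classical
  obtain ⟨J, hJ, hJk⟩ : ∃ J : Finset (Fin d), J.card = i ∧
      k ≤ (Finset.univ.filter fun r => ∃ j ∈ J, 0 < a r j).card := by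
    rcases hid.eq_or_lt with rfl | hlt
    · refine ⟨Finset.univ, by simp, ?_⟩
      rw [Finset.filter_true_of_mem]
      · simpa using hkq
      · intro r _
        obtain ⟨j, hj⟩ := Function.ne_iff.1 (hrow r)
        exact ⟨j, Finset.mem_univ j, lt_of_le_of_ne (ha r j) (Ne.symm hj)⟩
    · by_contra hcon
      push Not at hcon
      exact ((critIndex_eq_iff hi hid a).1 hcrit).2 (i + 1) (Finset.mem_Ioc.2 ⟨by omega, hlt⟩)
        (matTau_succ_lt_top hlt hk hkq ha hcon)
  refine ⟨J, hJ, fun z hz => ?_⟩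
  have hzo : z ∈ orthant d := fun j => by
    by_cases hj : j ∈ J
    exacts [(hz.1 j hj).le, (hz.2 j hj).ge]
  refine (mem_subcone_iff hk hkq).2 ⟨mulVec_mem_orthant ha hzo, ?_⟩
  rw [lt_ordStat_iff hk hkq]
  refine hJk.trans (Finset.card_le_card fun r => ?_)
  simp only [Finset.mem_filter, Finset.mem_univ, true_and]
  rintro ⟨j, hj, hpos⟩
  exact Finset.sum_pos' (fun c _ => mul_nonneg (ha r c) (hzo c))
    ⟨j, Finset.mem_univ j, mul_pos hpos (hz.1 j hj)⟩

end Matrices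

/-! ### Images under an independent random matrix -/

section RandomMatrix

variable {q d k i : ℕ}

theorem measurable_mulVec :
    Measurable fun p : Matrix (Fin q) (Fin d) ℝ × (Fin d → ℝ) => p.1 *ᵥ p.2 := by
  have : SecondCountableTopology (Matrix (Fin q) (Fin d) ℝ) :=
    inferInstanceAs (SecondCountableTopology (Fin q → Fin d → ℝ))
  exact (continuous_fst.matrix_mulVec continuous_snd).measurable

theorem IsTest.comp_mulVec (hi : 1 ≤ i) (hid : i ≤ d) (hk : 1 ≤ k) (hkq : k ≤ q)
    {F : (Fin q → ℝ) → ℝ} (hF : IsTest q k F) {a : Matrix (Fin q) (Fin d) ℝ}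
    (ha : ∀ r c, 0 ≤ a r c) (hτ : matTau a k i ≠ ∞) : IsTest d i fun z => F (a *ᵥ z) := by
  obtain ⟨M, hM⟩ := hF.bounded
  obtain ⟨r, hr, hv⟩ := hF.vanish
  have hτ0 : 0 ≤ (matTau a k i).toReal := ENNReal.toReal_nonneg
  refine ⟨hF.continuous.comp (continuous_const.matrix_mulVec continuous_id), ⟨M, fun z => hM _⟩,
    r / ((matTau a k i).toReal + 1), by positivity, fun z hz hzr => ?_⟩
  refine hv _ (mulVec_mem_orthant ha hz) ?_
  have h1 := ordStat_mulVec_le hi hid hk hkq hτ hz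
  have h2 := ordStat_nonneg hi hid hz
  rw [lt_div_iff₀ (by positivity)] at hzr
  nlinarith

theorem IsMMeasure.sigmaFinite (hi : 1 ≤ i) (hid : i ≤ d) {μ : Measure (Fin d → ℝ)}
    (hμ : IsMMeasure (orthant d) (axesUnion d (i - 1)) μ) : SigmaFinite μ := by
  have hm : ∀ n : ℕ, MeasurableSet (orthant d ∩ {z | 1 / (n + 1 : ℝ) ≤ ordStat z i}) := fun n =>
    measurableSet_orthant.inter (measurableSet_le measurable_const (measurable_ordStat hi hid))
  refine ⟨⟨⟨fun n : ℕ => (orthant d ∩ {z | 1 / (n + 1 : ℝ) ≤ ordStat z i}) ∪ (subcone d i)ᶜ,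
    fun _ => mem_univ _, fun n => ?_, ?_⟩⟩⟩
  · have hn : (0 : ℝ) < 1 / (n + 1) := by positivity
    refine (measure_union_le _ _).trans_lt ?_
    rw [show μ (subcone d i)ᶜ = 0 from hμ.carried, add_zero]
    refine hμ.finite _ (hm n) (fun z hz => ?_) ?_
    · exact (mem_subcone_iff hi hid).2 ⟨hz.1, hn.trans_le hz.2⟩
    · exact (boundedAway_axesUnion_iff hi hid inter_subset_left).2 ⟨_, hn, fun z hz => hz.2⟩
  · refine eq_univ_of_forall fun z => mem_iUnion.2 ?_
    by_cases hz : z ∈ subcone d i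
    · obtain ⟨hzo, hz0⟩ := (mem_subcone_iff hi hid).1 hz
      obtain ⟨n, hn⟩ := exists_nat_one_div_lt hz0
      exact ⟨n, Or.inl ⟨hzo, hn.le⟩⟩
    · exact ⟨0, Or.inr hz⟩

variable {Ω : Type*} [MeasurableSpace Ω] {P : Measure Ω} [IsProbabilityMeasure P]
  {Z : Ω → Fin d → ℝ} {A : Ω → Matrix (Fin q) (Fin d) ℝ} {α : ℝ} {μ : Measure (Fin d → ℝ)}

theorem measurableSet_critEvent (hi : 1 ≤ i) (hid : i ≤ d) (hk : 1 ≤ k) (hkq : k ≤ q)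
    (hA : Measurable A) : MeasurableSet (critEvent A k i) :=
  hA (measurableSet_critIndex_eq hi hid hk hkq)

/-- Independence lets the expectation be taken over the vector first, the matrix being fixed. -/
theorem setIntegral_critEvent_eq (hi : 1 ≤ i) (hid : i ≤ d) (hk : 1 ≤ k) (hkq : k ≤ q)
    (hA : Measurable A) (hZ : Measurable Z) (hAZ : IndepFun A Z P) {F : (Fin q → ℝ) → ℝ}
    (hF : IsTest q k F) (s : ℝ) :
    ∫ ω in critEvent A k i, F (s • (A ω *ᵥ Z ω)) ∂P =
      ∫ ω in critEvent A k i, ∫ ω', F (s • (A ω *ᵥ Z ω')) ∂P ∂P := by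
  obtain ⟨M, hM⟩ := hF.bounded
  set S : Set (Matrix (Fin q) (Fin d) ℝ) := {a | critIndex a k = i}
  have hS : MeasurableSet S := measurableSet_critIndex_eq hi hid hk hkq
  have hAm : IsProbabilityMeasure (P.map A) := Measure.isProbabilityMeasure_map hA.aemeasurable
  have hZm : IsProbabilityMeasure (P.map Z) := Measure.isProbabilityMeasure_map hZ.aemeasurable
  have hG : Measurable fun p : Matrix (Fin q) (Fin d) ℝ × (Fin d → ℝ) => F (s • (p.1 *ᵥ p.2)) :=
    hF.continuous.measurable.comp (measurable_mulVec.const_smul s)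
  have hΦ : Measurable ((S ×ˢ univ).indicator
      fun p : Matrix (Fin q) (Fin d) ℝ × (Fin d → ℝ) => F (s • (p.1 *ᵥ p.2))) :=
    hG.indicator (hS.prod MeasurableSet.univ)
  have hint : Integrable ((S ×ˢ univ).indicator
      fun p : Matrix (Fin q) (Fin d) ℝ × (Fin d → ℝ) => F (s • (p.1 *ᵥ p.2)))
      ((P.map A).prod (P.map Z)) :=
    (Integrable.of_bound hG.aestronglyMeasurable M (Eventually.of_forall fun p => hM _)).indicator
      (hS.prod MeasurableSet.univ)
  have h1 : ∫ ω in critEvent A k i, F (s • (A ω *ᵥ Z ω)) ∂P =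
      ∫ p, (S ×ˢ univ).indicator (fun p => F (s • (p.1 *ᵥ p.2))) p
        ∂((P.map A).prod (P.map Z)) := by
    rw [← (indepFun_iff_map_prod_eq_prod_map_map hA.aemeasurable hZ.aemeasurable).1 hAZ,
      integral_map (hA.prodMk hZ).aemeasurable hΦ.aestronglyMeasurable,
      ← integral_indicator (measurableSet_critEvent hi hid hk hkq hA)]
    refine integral_congr_ae (Eventually.of_forall fun ω => ?_)
    by_cases hω : critIndex (A ω) k = i <;> simp [indicator, critEvent, S, hω]
  rw [h1, integral_prod _ hint, integral_map hA.aemeasurable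
    hΦ.stronglyMeasurable.integral_prod_right'.aestronglyMeasurable,
    ← integral_indicator (measurableSet_critEvent hi hid hk hkq hA)]
  refine integral_congr_ae (Eventually.of_forall fun ω => ?_)
  have hGω : Measurable fun z : Fin d → ℝ => F (s • (A ω *ᵥ z)) := hG.comp measurable_prodMk_left
  by_cases hω : critIndex (A ω) k = i
  · simp only [indicator, critEvent, S, hω, mem_prod, mem_ofPred_eq, mem_univ, and_self, if_true]
    exact integral_map hZ.aemeasurable hGω.aestronglyMeasurable
  · simp [indicator, critEvent, S, hω]

theorem integrableOn_matTau_add_one_rpow (hk : 1 ≤ k) (hkq : k ≤ q) (hA : Measurable A)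
    {p : ℝ} (hp : 0 < p)
    (hmoment : ∫⁻ ω in critEvent A k i, matTau (A ω) k i ^ p ∂P < ∞) :
    IntegrableOn (fun ω => ((matTau (A ω) k i).toReal + 1) ^ p) (critEvent A k i) P := by
  have hτ : Measurable fun ω => matTau (A ω) k i := (measurable_matTau hk hkq i).comp hA
  have h1 : Integrable (fun ω => (matTau (A ω) k i).toReal ^ p)
      (P.restrict (critEvent A k i)) := by
    simp only [ENNReal.toReal_rpow]
    exact integrable_toReal_of_lintegral_ne_top (hτ.pow_const p).aemeasurable hmoment.ne
  refine Integrable.mono' ((h1.add (integrable_const 1)).const_mul (2 ^ p))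
    ((hτ.ennreal_toReal.add_const 1).pow_const p).aestronglyMeasurable
    (Eventually.of_forall fun ω => ?_)
  set x := (matTau (A ω) k i).toReal
  have hx : 0 ≤ x := ENNReal.toReal_nonneg
  have hxp : 0 ≤ x ^ p := Real.rpow_nonneg hx p
  rw [Real.norm_of_nonneg (by positivity)]
  calc (x + 1) ^ p ≤ (2 * max x 1) ^ p := by
        gcongr
        linarith [le_max_left x 1, le_max_right x 1]
    _ = 2 ^ p * max x 1 ^ p := Real.mul_rpow zero_le_two (by positivity)
    _ ≤ 2 ^ p * (x ^ p + 1) := by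
        gcongr
        rcases max_cases x 1 with ⟨h, _⟩ | ⟨h, _⟩ <;> rw [h]
        · linarith
        · rw [Real.one_rpow]; linarith

/-- For a fixed matrix, the normalised expectations of a test function are bounded by a multiple of
`(matTau a k i + 1) ^ p`, uniformly for large `t`. -/
theorem IsTest.exists_integral_mulVec_le (hi : 1 ≤ i) (hid : i ≤ d) (hk : 1 ≤ k) (hkq : k ≤ q)
    (hZ : Measurable Z) (hZo : ∀ ω, Z ω ∈ orthant d)
    (hb : IsRegVarInv (canonicalScaling P Z i) α) {p : ℝ} (hp : α < p)
    {F : (Fin q → ℝ) → ℝ} (hF : IsTest q k F) :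
    ∃ C : ℝ, ∀ᶠ t in atTop, ∀ a : Matrix (Fin q) (Fin d) ℝ, (∀ r c, 0 ≤ a r c) →
      matTau a k i ≠ ∞ → |(tail P Z i t)⁻¹ * ∫ ω, F (t⁻¹ • (a *ᵥ Z ω)) ∂P| ≤
        C * ((matTau a k i).toReal + 1) ^ p := by
  obtain ⟨M, hM⟩ := hF.bounded
  have hM0 : 0 ≤ M := (abs_nonneg _).trans (hM 0)
  obtain ⟨r, hr, hv⟩ := hF.vanish
  obtain ⟨C, t₀, hC, hpot⟩ := exists_tail_div_le hi hid hZ hZo hb hp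
  refine ⟨M * C * (1 / r + 1) ^ p, ?_⟩
  filter_upwards [eventually_ge_atTop t₀, eventually_gt_atTop 0] with t ht ht0 a ha hτ
  set τ := (matTau a k i).toReal with hτdef
  have hτ0 : 0 ≤ τ := ENNReal.toReal_nonneg
  have hr1 : 0 < 1 / r := by positivity
  -- `u` is chosen so that `F (a z / t) ≠ 0` forces `z^{(i)} > t / u`.
  set u : ℝ := (1 / r + 1) * (τ + 1) with hu
  have hu1 : 1 ≤ u := by nlinarith
  have hur : τ < u * r := by
    have : u * r = (1 + r) * (τ + 1) := by rw [hu]; field_simp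
    nlinarith
  have hm : MeasurableSet {ω | t / u < ordStat (Z ω) i} :=
    measurableSet_lt measurable_const ((measurable_ordStat hi hid).comp hZ)
  have hbound : |∫ ω, F (t⁻¹ • (a *ᵥ Z ω)) ∂P| ≤ M * tail P Z i (t / u) := by
    rw [← Real.norm_eq_abs, tail, ← integral_indicator_one hm, ← integral_const_mul]
    refine norm_integral_le_of_norm_le
      (((integrable_const (μ := P) (1 : ℝ)).indicator hm).const_mul M) (Eventually.of_forall fun ω => ?_)
    by_cases hω : t / u < ordStat (Z ω) i
    · rw [indicator_of_mem (show ω ∈ {ω | t / u < ordStat (Z ω) i} from hω)]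
      simpa using hM _
    · have hzero : F (t⁻¹ • (a *ᵥ Z ω)) = 0 := by
        refine hv _ (smul_mem_orthant (inv_nonneg.2 ht0.le) (mulVec_mem_orthant ha (hZo ω))) ?_
        rw [ordStat_smul hk hkq (inv_pos.2 ht0), inv_mul_lt_iff₀ ht0]
        have h1 := ordStat_mulVec_le hi hid hk hkq hτ (hZo ω)
        have h2 := ordStat_nonneg hi hid (hZo ω)
        have h3 : ordStat (Z ω) i * u ≤ t := by
          rw [not_lt, le_div_iff₀ (by linarith)] at hω
          exact hω
        rcases h2.eq_or_lt with h4 | h4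
        · rw [← h4, mul_zero] at h1
          exact h1.trans_lt (by positivity)
        · calc ordStat (a *ᵥ Z ω) k ≤ τ * ordStat (Z ω) i := h1
            _ < u * r * ordStat (Z ω) i := by gcongr
            _ = ordStat (Z ω) i * u * r := by ring
            _ ≤ t * r := by gcongr
      rw [hzero, norm_zero]
      exact mul_nonneg hM0 (indicator_nonneg (fun _ _ => zero_le_one) _)
  have hG := tail_pos hi hid hZ hZo hb t
  rw [abs_mul, abs_of_pos (inv_pos.2 hG), inv_mul_le_iff₀ hG]
  calc |∫ ω, F (t⁻¹ • (a *ᵥ Z ω)) ∂P| ≤ M * tail P Z i (t / u) := hbound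
    _ ≤ M * (C * u ^ p * tail P Z i t) := by gcongr; exact hpot t ht u hu1
    _ = _ := by rw [hu, Real.mul_rpow (by positivity) (by positivity)]; ring

theorem IsTest.stronglyMeasurable_integral_mulVec {Ω' : Type*} [MeasurableSpace Ω']
    (hA : Measurable A) {F : (Fin q → ℝ) → ℝ} (hF : IsTest q k F) {Q : Measure Ω'} [SFinite Q]
    {W : Ω' → Fin d → ℝ} (hW : Measurable W) (s : ℝ) :
    StronglyMeasurable fun ω => ∫ ω', F (s • (A ω *ᵥ W ω')) ∂Q := by
  have : Measurable fun p : Ω × Ω' => F (s • (A p.1 *ᵥ W p.2)) :=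
    hF.continuous.measurable.comp ((measurable_mulVec.comp
      ((hA.comp measurable_fst).prodMk (hW.comp measurable_snd))).const_smul s)
  exact this.stronglyMeasurable.integral_prod_right

theorem IsMRV.tendsto_integral_mulVec (hi : 1 ≤ i) (hid : i ≤ d) (hk : 1 ≤ k) (hkq : k ≤ q)
    (hZ : IsMRV P Z α (canonicalScaling P Z i) μ (orthant d) (axesUnion d (i - 1)))
    {F : (Fin q → ℝ) → ℝ} (hF : IsTest q k F) {a : Matrix (Fin q) (Fin d) ℝ}
    (ha : ∀ r c, 0 ≤ a r c) (hτ : matTau a k i ≠ ∞) :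
    Tendsto (fun t => (tail P Z i t)⁻¹ * ∫ ω, F (t⁻¹ • (a *ᵥ Z ω)) ∂P) atTop
      (𝓝 (∫ z, F (a *ᵥ z) ∂μ)) := by
  have h := hZ.tendsto_integral_div_tail hi hid (hF.comp_mulVec hi hid hk hkq ha hτ)
  simpa only [Matrix.mulVec_smul] using h

/-- Dominated convergence over the random matrix, the dominating function being integrable by the
moment condition. -/
theorem IsMRV.tendsto_setIntegral_critEvent (hi : 1 ≤ i) (hid : i ≤ d) (hk : 1 ≤ k) (hkq : k ≤ q)
    (hZ : IsMRV P Z α (canonicalScaling P Z i) μ (orthant d) (axesUnion d (i - 1)))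
    (hA : Measurable A) (hA_nonneg : ∀ ω r c, 0 ≤ A ω r c) (hAZ : IndepFun A Z P) {p : ℝ}
    (hp : α < p) (hmoment : ∫⁻ ω in critEvent A k i, matTau (A ω) k i ^ p ∂P < ∞)
    {F : (Fin q → ℝ) → ℝ} (hF : IsTest q k F) :
    IntegrableOn (fun ω => ∫ z, F (A ω *ᵥ z) ∂μ) (critEvent A k i) P ∧
    Tendsto (fun t => (tail P Z i t)⁻¹ * ∫ ω in critEvent A k i, F (t⁻¹ • (A ω *ᵥ Z ω)) ∂P) atTop
      (𝓝 (∫ ω in critEvent A k i, ∫ z, F (A ω *ᵥ z) ∂μ ∂P)) := by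
  have hσ := hZ.tendsto.limit_mem.sigmaFinite hi hid
  have hS := measurableSet_critEvent (A := A) hi hid hk hkq hA
  obtain ⟨C, hC⟩ := hF.exists_integral_mulVec_le hi hid hk hkq hZ.measurable hZ.mem_cone
    hZ.scaling hp
  have hdom := (integrableOn_matTau_add_one_rpow hk hkq hA (hZ.scaling.nonneg.trans_lt hp)
    hmoment).const_mul C
  have hfin : ∀ᵐ ω ∂P.restrict (critEvent A k i), matTau (A ω) k i ≠ ∞ := by
    filter_upwards [ae_restrict_mem hS] with ω hω
    exact ((critIndex_eq_iff hi hid (A ω)).1 hω).1.ne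
  have hlim : ∀ᵐ ω ∂P.restrict (critEvent A k i),
      Tendsto (fun t => (tail P Z i t)⁻¹ * ∫ ω', F (t⁻¹ • (A ω *ᵥ Z ω')) ∂P) atTop
        (𝓝 (∫ z, F (A ω *ᵥ z) ∂μ)) := by
    filter_upwards [hfin] with ω hω
    exact hZ.tendsto_integral_mulVec hi hid hk hkq hF (hA_nonneg ω) hω
  constructor
  · refine Integrable.mono' hdom ?_ ?_
    · have := hF.stronglyMeasurable_integral_mulVec hA (Q := μ) measurable_id 1
      simp only [one_smul, id] at this
      exact this.aestronglyMeasurable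
    · filter_upwards [hfin, hlim] with ω h1 h2
      refine le_of_tendsto h2.norm ?_
      filter_upwards [hC] with t ht using ht (A ω) (hA_nonneg ω) h1
  · have h := tendsto_integral_filter_of_dominated_convergence _
      (Eventually.of_forall fun t => ((hF.stronglyMeasurable_integral_mulVec hA (Q := P)
        hZ.measurable t⁻¹).const_mul (tail P Z i t)⁻¹).aestronglyMeasurable) ?_ hdom hlim
    · refine h.congr fun t => ?_
      rw [integral_const_mul, setIntegral_critEvent_eq hi hid hk hkq hA hZ.measurable hAZ hF]
    · filter_upwards [hC] with t ht
      filter_upwards [hfin] with ω hω using ht (A ω) (hA_nonneg ω) hω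

end RandomMatrix

/-! ### The limit measure -/

section LimitMeasure

variable {Ω : Type*} [MeasurableSpace Ω] {q d k i : ℕ}

/-- The limit measure `B ↦ ∫ μ {z | A z ∈ B} dP`, the integral being over `critEvent A k i`. It is
encoded as the image of the product measure under `(ω, z) ↦ A ω z`, restricted to `E_q^{(k)}`. -/
noncomputable def limitMeasure (P : Measure Ω) (A : Ω → Matrix (Fin q) (Fin d) ℝ) (k i : ℕ)
    (μ : Measure (Fin d → ℝ)) : Measure (Fin q → ℝ) :=
  (((P.restrict (critEvent A k i)).prod μ).map fun p => A p.1 *ᵥ p.2).restrict (subcone q k)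

variable {P : Measure Ω} {Z : Ω → Fin d → ℝ}
  {A : Ω → Matrix (Fin q) (Fin d) ℝ} {α : ℝ} {μ : Measure (Fin d → ℝ)}

theorem measurable_comp_mulVec (hA : Measurable A) :
    Measurable fun p : Ω × (Fin d → ℝ) => A p.1 *ᵥ p.2 :=
  measurable_mulVec.comp ((hA.comp measurable_fst).prodMk measurable_snd)

theorem limitMeasure_apply [SFinite μ] (hA : Measurable A) (hμ : ∀ᵐ z ∂μ, z ∈ subcone d i)
    {B : Set (Fin q → ℝ)} (hB : MeasurableSet B) (hBs : B ⊆ subcone q k) :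
    limitMeasure P A k i μ B =
      ∫⁻ ω in critEvent A k i, μ {z ∈ subcone d i | A ω *ᵥ z ∈ B} ∂P := by
  have hX := measurable_comp_mulVec hA
  rw [limitMeasure, Measure.restrict_apply hB, inter_eq_left.2 hBs, Measure.map_apply hX hB,
    Measure.prod_apply (hX hB)]
  refine lintegral_congr fun ω => measure_congr ?_
  filter_upwards [hμ] with z hz
  exact propext ⟨fun h => ⟨hz, h⟩, fun h => h.2⟩

theorem isMMeasure_limitMeasure [IsProbabilityMeasure P] (hi : 1 ≤ i) (hid : i ≤ d) (hk : 1 ≤ k) (hkq : k ≤ q)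
    (hZ : IsMRV P Z α (canonicalScaling P Z i) μ (orthant d) (axesUnion d (i - 1)))
    (hA : Measurable A) (hA_nonneg : ∀ ω r c, 0 ≤ A ω r c) (hAZ : IndepFun A Z P) {p : ℝ}
    (hp : α < p) (hmoment : ∫⁻ ω in critEvent A k i, matTau (A ω) k i ^ p ∂P < ∞) :
    IsMMeasure (orthant q) (axesUnion q (k - 1)) (limitMeasure P A k i μ) := by
  have hμ := hZ.tendsto.limit_mem
  have hσ := hμ.sigmaFinite hi hid
  have hS := measurableSet_critEvent (A := A) hi hid hk hkq hA
  refine ⟨?_, fun B hB hBs hBa => ?_⟩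
  · have := measurableSet_subcone hk hkq
    change limitMeasure P A k i μ (subcone q k)ᶜ = 0
    rw [limitMeasure, Measure.restrict_apply this.compl, compl_inter_self, measure_empty]
  · obtain ⟨r, hr, hBr⟩ := (boundedAway_axesUnion_iff hk hkq fun x hx => (hBs hx).1).1 hBa
    have hF := isTest_ramp hk hkq hr
    have hint := (hZ.tendsto_setIntegral_critEvent hi hid hk hkq hA hA_nonneg hAZ hp hmoment hF).1
    rw [limitMeasure_apply hA hμ.carried hB hBs]
    refine lt_of_le_of_lt (lintegral_mono_ae ?_) hint.lintegral_lt_top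
    filter_upwards [ae_restrict_mem hS] with ω hω
    have hτ := ((critIndex_eq_iff hi hid (A ω)).1 hω).1.ne
    have hFi := (hF.comp_mulVec hi hid hk hkq (hA_nonneg ω) hτ).integrable hi hid hμ
    have hBω : MeasurableSet {z : Fin d → ℝ | A ω *ᵥ z ∈ B} :=
      ((measurable_comp_mulVec hA).comp measurable_prodMk_left) hB
    rw [ofReal_integral_eq_lintegral_ofReal hFi (Eventually.of_forall fun z => ramp_nonneg _ _)]
    calc μ {z ∈ subcone d i | A ω *ᵥ z ∈ B} ≤ μ {z | A ω *ᵥ z ∈ B} :=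
          measure_mono fun z hz => hz.2
      _ = ∫⁻ z, {z : Fin d → ℝ | A ω *ᵥ z ∈ B}.indicator 1 z ∂μ := (lintegral_indicator_one hBω).symm
      _ ≤ _ := by
        refine lintegral_mono fun z => ?_
        by_cases hz : A ω *ᵥ z ∈ B
        · rw [indicator_of_mem (show z ∈ {z : Fin d → ℝ | A ω *ᵥ z ∈ B} from hz),
            ramp_eq_one hr (hBr _ hz)]
          simp
        · rw [indicator_of_notMem (show z ∉ {z : Fin d → ℝ | A ω *ᵥ z ∈ B} from hz)]
          exact zero_le

theorem IsTest.setIntegral_limitMeasure [SFinite P] [SFinite μ] (hk : 1 ≤ k) (hkq : k ≤ q)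
    (hA : Measurable A) (hA_nonneg : ∀ ω r c, 0 ≤ A ω r c) (hμ : ∀ᵐ z ∂μ, z ∈ orthant d)
    (hν : IsMMeasure (orthant q) (axesUnion q (k - 1)) (limitMeasure P A k i μ))
    {F : (Fin q → ℝ) → ℝ} (hF : IsTest q k F) :
    ∫ z in subcone q k, F z ∂limitMeasure P A k i μ =
      ∫ ω in critEvent A k i, ∫ z, F (A ω *ᵥ z) ∂μ ∂P := by
  have hX := measurable_comp_mulVec hA
  have hS := measurableSet_subcone hk hkq
  set Q := (P.restrict (critEvent A k i)).prod μ with hQ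
  have horth : ∀ᵐ p ∂Q, A p.1 *ᵥ p.2 ∈ orthant q := by
    filter_upwards [Measure.quasiMeasurePreserving_snd.ae hμ] with p hp
    exact mulVec_mem_orthant (hA_nonneg p.1) hp
  have h1 := hF.setIntegral_smul_map hk hkq Q hX horth 1
  rw [one_smul, ENNReal.toReal_one, one_mul] at h1
  have hint : Integrable (fun p : Ω × (Fin d → ℝ) => F (A p.1 *ᵥ p.2)) Q := by
    have h2 := hF.integrable hk hkq hν
    rw [limitMeasure, Measure.restrict_map hX hS] at h2
    have h3 : IntegrableOn (fun p : Ω × (Fin d → ℝ) => F (A p.1 *ᵥ p.2))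
        ((fun p : Ω × (Fin d → ℝ) => A p.1 *ᵥ p.2) ⁻¹' subcone q k) Q :=
      (integrable_map_measure hF.continuous.aestronglyMeasurable hX.aemeasurable).1 h2
    refine h3.integrable_of_ae_notMem_eq_zero ?_
    filter_upwards [horth] with p hp hn using hF.eq_zero_of_notMem hk hkq hp hn
  rw [← integral_prod _ hint]
  exact h1

/-- Almost every matrix of critical index `i` maps an open face of dimension `i` into `E_q^{(k)}`,
and these faces are charged by `μ`. -/
theorem limitMeasure_ne_zero [SFinite μ] (hi : 1 ≤ i) (hid : i ≤ d) (hk : 1 ≤ k) (hkq : k ≤ q)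
    (hA : Measurable A) (hA_nonneg : ∀ ω r c, 0 ≤ A ω r c) (hA_rows : ∀ᵐ ω ∂P, ∀ r, A ω r ≠ 0)
    (hfaces : ∀ J : Finset (Fin d), J.card = i → 0 < μ (openFace J))
    (hpos : 0 < P (critEvent A k i)) : limitMeasure P A k i μ ≠ 0 := by
  intro h0
  have hX := measurable_comp_mulVec hA
  have hS := measurableSet_subcone hk hkq
  have h1 : limitMeasure P A k i μ (subcone q k) = 0 := by rw [h0]; rfl
  rw [limitMeasure, Measure.restrict_apply hS, inter_self, Measure.map_apply hX hS,
    Measure.measure_prod_null (hX hS)] at h1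
  have h2 : ∀ᵐ ω ∂P.restrict (critEvent A k i), False := by
    filter_upwards [h1, ae_restrict_of_ae hA_rows,
      ae_restrict_mem (measurableSet_critEvent hi hid hk hkq hA)] with ω h3 hrow hω
    obtain ⟨J, hJ, hmaps⟩ := exists_openFace_mapsTo hi hid hk hkq (hA_nonneg ω) hrow hω
    exact (hfaces J hJ).ne' (measure_mono_null (fun z hz => hmaps z hz) h3)
  rw [eventually_false_iff_eq_bot, ae_eq_bot, Measure.restrict_eq_zero] at h2
  exact hpos.ne' h2

end LimitMeasure

end HiddenRV

theorem mainTheorem1 {Ω : Type*} [MeasurableSpace Ω] (P : Measure Ω) [IsProbabilityMeasure P]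
    (d q i k : ℕ) (hi : 1 ≤ i) (hid : i ≤ d) (hk : 1 ≤ k) (hkq : k ≤ q)
    (Z : Ω → Fin d → ℝ) (α : ℝ) (μ : Measure (Fin d → ℝ))
    (hZ : IsMRV P Z α (canonicalScaling P Z i) μ (orthant d) (axesUnion d (i - 1)))
    (A : Ω → Matrix (Fin q) (Fin d) ℝ) (hA : Measurable A)
    (hA_nonneg : ∀ ω r c, 0 ≤ A ω r c)
    (hA_rows : ∀ᵐ ω ∂P, ∀ r, A ω r ≠ 0)
    (hAZ : IndepFun A Z P)
    (δ : ℝ) (hδ : 0 < δ)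
    (hmoment : ∫⁻ ω in critEvent A k i, matTau (A ω) k i ^ (α + δ) ∂P < ∞)
    (hfaces : ∀ J : Finset (Fin d), J.card = i → 0 < μ (openFace J)) :
    ∃ ν : Measure (Fin q → ℝ),
      (∀ B, MeasurableSet B → B ⊆ subcone q k →
        ν B = ∫⁻ ω in critEvent A k i, μ {z ∈ subcone d i | A ω *ᵥ z ∈ B} ∂P) ∧
      MTendsto (orthant q) (axesUnion q (k - 1))
        (fun t : ℝ => (P {ω | t < ordStat (Z ω) i})⁻¹ •
          ((P.restrict (critEvent A k i)).map fun ω => t⁻¹ • (A ω *ᵥ Z ω)).restrict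
            (subcone q k))
        atTop ν ∧
      (0 < P (critEvent A k i) → ν ≠ 0) := by
  have hμ := hZ.tendsto.limit_mem
  have hσ := hμ.sigmaFinite hi hid
  have hp : α < α + δ := by linarith
  have hS := measurableSet_subcone hk hkq
  have hν := isMMeasure_limitMeasure hi hid hk hkq hZ hA hA_nonneg hAZ hp hmoment
  refine ⟨limitMeasure P A k i μ, fun B hB hBs => limitMeasure_apply hA hμ.carried hB hBs,
    ⟨Eventually.of_forall fun t => ⟨?_, fun B hB _ _ => ?_⟩, hν, fun f hf hfb hfs => ?_⟩,
    limitMeasure_ne_zero hi hid hk hkq hA hA_nonneg hA_rows hfaces⟩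
  · change (_ • Measure.restrict _ (subcone q k)) (subcone q k)ᶜ = 0
    rw [Measure.smul_apply, Measure.restrict_apply hS.compl, compl_inter_self, measure_empty,
      smul_zero]
  · have hpos := tail_pos hi hid hZ.measurable hZ.mem_cone hZ.scaling t
    rw [Measure.smul_apply, smul_eq_mul]
    refine ENNReal.mul_lt_top (ENNReal.inv_lt_top.2 ?_) (measure_lt_top _ _)
    exact pos_iff_ne_zero.2 fun h => by simp [tail, Measure.real, h] at hpos
  · obtain ⟨F, hF, hfF⟩ := exists_isTest_eqOn hk hkq hf hfb hfs
    have hcongr : ∀ ρ : Measure (Fin q → ℝ),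
        ∫ x in orthant q \ axesUnion q (k - 1), f x ∂ρ = ∫ x in subcone q k, F x ∂ρ :=
      fun ρ => setIntegral_congr_fun hS hfF
    simp only [hcongr]
    have hμo : ∀ᵐ z ∂μ, z ∈ orthant d := by
      filter_upwards [show ∀ᵐ z ∂μ, z ∈ subcone d i from hμ.carried] with z hz using hz.1
    rw [hF.setIntegral_limitMeasure hk hkq hA hA_nonneg hμo hν]
    refine (hZ.tendsto_setIntegral_critEvent hi hid hk hkq hA hA_nonneg hAZ hp hmoment hF).2.congr'
      ?_
    filter_upwards [eventually_ge_atTop 0] with t ht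
    have hX : Measurable fun ω => t⁻¹ • (A ω *ᵥ Z ω) :=
      (measurable_mulVec.comp (hA.prodMk hZ.measurable)).const_smul t⁻¹
    rw [hF.setIntegral_smul_map hk hkq (P.restrict (critEvent A k i)) hX
      (ae_of_all _ fun ω => smul_mem_orthant (inv_nonneg.2 ht)
        (mulVec_mem_orthant (hA_nonneg ω) (hZ.mem_cone ω))), ENNReal.toReal_inv]
    rfl
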